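/- Let $\mathcal J$ be the family of independent sets of a matroid on the set $\{1,\dots,n\}$ of bidders. Bidder $i$ has a value $v_i\ge 0$ for being served, drawn independently from a distribution $\mathcal D_i$ on $[0,\infty)$ with density $f_i$ and cumulative distribution function $F_i$; a set of bidders may be served together iff it belongs to $\mathcal J$. The distribution $\mathcal D_i$ is MHR if the hazard rate $f_i(v)/(1-F_i(v))$ is nondecreasing, and regular if the virtual value $v-(1-F_i(v))/f_i(v)$ is nondecreasing, both on $\{v\ge 0: F_i(v)<1\}$ (where $f_i(v)=0$ the virtual value is $-\infty$). A single-sample sequential posted-price mechanism (SPM) does not know the distributions; it has access to random coins and to one sample $s=(s_1,\dots,s_n)$ drawn from $\mathcal D=\mathcal D_1\times\dots\times\mathcal D_n$, independent of the values. It serves the bidders one at a time, in an order that it chooses, and offers each bidder a price in $[0,\infty]$ that depends only on the coins, the sample and the bids of the bidders served before. A bidder is served, and pays the price offered, iff the bid exceeds that price. Its revenue competitive ratio is (at least) $\alpha$ if its expected revenue is at least $\alpha$ times the expected revenue of every (possibly randomized, distribution-dependent) feasible, dominant strategy truthful and individually rational mechanism; its welfare competitive ratio is (at least) $\alpha$ if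 the expected total value of the served bidders is at least $\alpha\cdot\mathbb E_{v\leftarrow\mathcal D}\big[\max_{S\in\mathcal J}\sum_{i\in S}v_i\big]$. **Theorem.** For every matroid $\mathcal J$ on $\{1,\dots,n\}$ there is a single-sample SPM (depending only on $\mathcal J$) that always serves a set in $\mathcal J$ and is dominant strategy truthful and individually rational for every outcome of its coins and of the sample, such that: 1. whenever all $\mathcal D_i$ are MHR (not necessarily identical), it has revenue competitive ratio $\frac1{8e}$ and welfare competitive ratio $\frac18$; 2. whenever the $\mathcal D_i$ are identical and regular, the same mechanism has revenue competitive ratio $\frac18$. -/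

import Mathlib

open MeasureTheory ProbabilityTheory
open scoped ENNReal

noncomputable section

/-! ### Value distributions -/

/-- `f` is a probability density function of `D` with respect to Lebesgue measure. -/
structure IsPdf (f : ℝ → ℝ) (D : Measure ℝ) : Prop where
  measurable : Measurable f
  nonneg : ∀ v, 0 ≤ f v
  eq_withDensity : D = volume.withDensity (fun v => ENNReal.ofReal (f v))

/-- The hazard rate `f(v) / (1 - F(v))`; only meaningful where `F(v) < 1`. -/
def hazardRate (f : ℝ → ℝ) (D : Measure ℝ) (v : ℝ) : ℝ := f v / (1 - cdf D v)

open Classical in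
/-- The virtual value `v - (1 - F(v)) / f(v)`, read as `-∞` where `F(v) < 1` and `f(v) = 0`;
only meaningful where `F(v) < 1`. -/
def virtualValue (f : ℝ → ℝ) (D : Measure ℝ) (v : ℝ) : EReal :=
  if f v = 0 then ⊥ else ((v - (1 - cdf D v) / f v : ℝ) : EReal)

/-- A distribution of non-negative values with a density has monotone hazard rate if (for some
version of the density) the hazard rate is nondecreasing where it is defined. -/
def IsMHRDist (D : Measure ℝ) : Prop :=
  D (Set.Iio 0) = 0 ∧
    ∃ f, IsPdf f D ∧ MonotoneOn (hazardRate f D) {v | 0 ≤ v ∧ cdf D v < 1}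

/-- A distribution of non-negative values with a density is regular if (for some version of the
density) the virtual value is nondecreasing where it is defined. -/
def IsRegularDist (D : Measure ℝ) : Prop :=
  D (Set.Iio 0) = 0 ∧
    ∃ f, IsPdf f D ∧ MonotoneOn (virtualValue f D) {v | 0 ≤ v ∧ cdf D v < 1}

/-- Expectation of a real random variable as an extended real: the mean of the positive part minus
the mean of the negative part (`-∞` if the latter is infinite). -/
def extMean {Ω : Type*} [MeasurableSpace Ω] (μ : Measure Ω) (g : Ω → ℝ) : EReal :=
  ((∫⁻ ω, ENNReal.ofReal (g ω) ∂μ : ℝ≥0∞) : EReal) -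
    ((∫⁻ ω, ENNReal.ofReal (-g ω) ∂μ : ℝ≥0∞) : EReal)

/-! ### Single-dimensional mechanisms -/

/-- A direct mechanism `(x, p)`: `x b i` is the probability that bidder `i` is served and `p b i`
the expected payment of bidder `i` when the reported bids are `b`. -/
structure Mechanism (n : ℕ) where
  x : (Fin n → ℝ) → Fin n → ℝ
  p : (Fin n → ℝ) → Fin n → ℝ

namespace Mechanism

variable {n : ℕ}

/-- Expected utility of bidder `i` with true value `t` when the reported bids are `b`. -/
def utility (A : Mechanism n) (i : Fin n) (t : ℝ) (b : Fin n → ℝ) : ℝ :=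
  A.x b i * t - A.p b i

/-- Dominant strategy truthfulness, for non-negative values and bids. -/
def Truthful (A : Mechanism n) : Prop :=
  ∀ (i : Fin n) (t : ℝ) (b : Fin n → ℝ), 0 ≤ t → (∀ j, 0 ≤ b j) →
    A.utility i t b ≤ A.utility i t (Function.update b i t)

/-- A truthful report never leads to negative utility. -/
def IndividuallyRational (A : Mechanism n) : Prop :=
  ∀ (i : Fin n) (t : ℝ) (b : Fin n → ℝ), 0 ≤ t → (∀ j, 0 ≤ b j) →
    0 ≤ A.utility i t (Function.update b i t)

/-- For all non-negative bids the service probabilities come from a probability distribution over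
sets of bidders that are independent in the matroid. -/
def Feasible (A : Mechanism n) (M : Matroid (Fin n)) : Prop :=
  ∀ b : Fin n → ℝ, (∀ j, 0 ≤ b j) →
    A.x b ∈ convexHull ℝ {y : Fin n → ℝ | ∃ S, M.Indep S ∧ y = S.indicator 1}

/-- The expected revenue when the values are drawn from the product of the `D i` and reported
truthfully. -/
def revenue (A : Mechanism n) (D : Fin n → Measure ℝ) : EReal :=
  extMean (Measure.pi D) (fun v => ∑ i, A.p v i)

end Mechanism

/-- The largest total value `OPT(v)` of an independent set of the matroid. -/
def optWelfare {n : ℕ} (M : Matroid (Fin n)) (v : Fin n → ℝ) : ℝ :=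
  ⨆ S : {S : Finset (Fin n) // M.Indep (S : Set (Fin n))}, ∑ i ∈ S.1, v i

/-! ### Single-sample sequential posted-price mechanisms -/

/-- A sequential posted-price mechanism for `n` bidders that has access to random coins and to one
sample `s i` of the value of each bidder `i`, but not to the distributions.

Given coins `c` and samples `s`, the bidders are served in the order
`order c s 0, order c s 1, …`. When the bids are `b`, bidder `i` is offered service at the price
`price c s b i`; this price depends only on the bids of the bidders served before `i`. The price
`∞` means that service is refused. -/
structure SingleSampleSPM (n : ℕ) where
  Coin : Type
  [measurableSpaceCoin : MeasurableSpace Coin]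
  coinLaw : Measure Coin
  [isProbabilityMeasure_coinLaw : IsProbabilityMeasure coinLaw]
  order : Coin → (Fin n → ℝ) → Equiv.Perm (Fin n)
  price : Coin → (Fin n → ℝ) → (Fin n → ℝ) → Fin n → ℝ≥0∞
  price_online : ∀ (c : Coin) (s b b' : Fin n → ℝ) (k : Fin n),
    (∀ j < k, b (order c s j) = b' (order c s j)) →
      price c s b (order c s k) = price c s b' (order c s k)
  measurable_price : ∀ i : Fin n,
    Measurable (fun q : Coin × (Fin n → ℝ) × (Fin n → ℝ) => price q.1 q.2.1 q.2.2 i)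

namespace SingleSampleSPM

variable {n : ℕ}

attribute [instance] measurableSpaceCoin isProbabilityMeasure_coinLaw

/-- The set of bidders who are served: those whose bid exceeds the price offered to them. -/
def winners (P : SingleSampleSPM n) (c : P.Coin) (s b : Fin n → ℝ) : Set (Fin n) :=
  {i | P.price c s b i < ENNReal.ofReal (b i)}

/-- The deterministic direct mechanism obtained by fixing the coins and the samples: winners are
served and pay the price that they were offered, the others pay nothing. -/
def toMechanism (P : SingleSampleSPM n) (c : P.Coin) (s : Fin n → ℝ) : Mechanism n where
  x b := (P.winners c s b).indicator 1
  p b := (P.winners c s b).indicator (fun i => (P.price c s b i).toReal)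

/-- The joint law of the coins, the samples and the values: all are independent, and sample and
value of bidder `i` both have law `D i`. -/
def law (P : SingleSampleSPM n) (D : Fin n → Measure ℝ) :
    Measure (P.Coin × (Fin n → ℝ) × (Fin n → ℝ)) :=
  P.coinLaw.prod ((Measure.pi D).prod (Measure.pi D))

/-- Expected revenue, over coins, samples and values. -/
def revenue (P : SingleSampleSPM n) (D : Fin n → Measure ℝ) : EReal :=
  extMean (P.law D) (fun q => ∑ i, (P.toMechanism q.1 q.2.1).p q.2.2 i)

/-- Expected welfare (total value of the winners), over coins, samples and values. -/
def welfare (P : SingleSampleSPM n) (D : Fin n → Measure ℝ) : EReal :=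
  extMean (P.law D) (fun q => ∑ i, (P.toMechanism q.1 q.2.1).x q.2.2 i * q.2.2 i)

/-- The winners always form an independent set. -/
def Feasible (P : SingleSampleSPM n) (M : Matroid (Fin n)) : Prop :=
  ∀ (c : P.Coin) (s b : Fin n → ℝ), M.Indep (P.winners c s b)

/-- Truthfulness and individual rationality for every outcome of the coins and samples. -/
def Truthful (P : SingleSampleSPM n) : Prop :=
  ∀ (c : P.Coin) (s : Fin n → ℝ),
    (P.toMechanism c s).Truthful ∧ (P.toMechanism c s).IndividuallyRational

/-- The expected revenue is at least `α` times the expected revenue of every feasible, truthful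
and individually rational mechanism (which may be tailored to the distributions). -/
def RevenueCompetitive (P : SingleSampleSPM n) (M : Matroid (Fin n)) (D : Fin n → Measure ℝ)
    (α : ℝ) : Prop :=
  ∀ A : Mechanism n, Measurable A.x → Measurable A.p →
    A.Feasible M → A.Truthful → A.IndividuallyRational →
      (α : EReal) * A.revenue D ≤ P.revenue D

/-- The expected welfare is at least `α` times the expected optimal welfare. -/
def WelfareCompetitive (P : SingleSampleSPM n) (M : Matroid (Fin n)) (D : Fin n → Measure ℝ)
    (α : ℝ) : Prop :=
  (α : EReal) * extMean (Measure.pi D) (optWelfare M) ≤ P.welfare D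

end SingleSampleSPM

end

/-! The coins draw a uniformly random set `A` of bidders who are never served. Any other bidder `i`
gets as reserve price the larger of the own sample `s i` and the threshold set by the samples of
`A`, the largest weight level at which `A` spans `i`. Bidders come in order of decreasing threshold
and are refused if serving them would break independence.

Benchmark. For distinct positive weights, the non-loops exceeding their threshold against all other
elements form a set (`greedySet`) that is at least as good as any independent set, for every
nonnegative weighting monotone in the given weights. The threshold `θ` of `i` ignores the value of
`i`, so the benchmark splits into terms, one per non-loop, that depend only on `D i` and `θ`
(`lintegral_sum_greedySet`).

Sampling. Exchanging samples and values on `A` preserves the law, so the threshold `t` from `A` and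
the threshold from the remaining bidders may be read off one vector. Comparing `A` with its
complement, with probability at least 1/4 the set `A` avoids `i` and `t` is the larger of the two.
Then the bidders served before `i` do not span `i`, so `i` is offered `max t s` with a fresh sample
`s`; monotonicity gives `t ≤ θ`. This reduces everything to one bidder
(`lintegral_threshold_le_sampleSPM`), at a cost of 4.

One bidder. Sample and value are exchangeable, which costs a factor 2 for welfare. For MHR revenue
the tail bound `G (2 x) ≤ G x ^ 2`, with `G` the survival function, gives a factor 4, and 16 ≤ 8e.
For identical regular distributions the benchmark is Myerson's virtual value bound, with a boundary
term `revenueAtTop` for heavy tails. Above `θ` it is bounded through revenues of posted prices `a ≥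
θ`, and a random price `max t s` earns half of each of these because the revenue curve lies above
its chords to the quantile-one endpoint; the factor is 2. -/

open scoped NNReal

/-! ### Thresholds and greedy sets of a weighted matroid -/

namespace Matroid

variable {n : ℕ} (M : Matroid (Fin n))

open Classical in
/-- The largest weight `a` of an element of `X` such that `i` is spanned by the elements of `X`
of weight at least `a` (zero if there is none). -/
noncomputable def threshold (i : Fin n) (X : Finset (Fin n)) (w : Fin n → ℝ) : ℝ≥0 :=
  X.sup fun j => if i ∈ M.closure {k | k ∈ X ∧ w j ≤ w k} then (w j).toNNReal else 0

/-- The non-loops whose weight exceeds their threshold with respect to all other elements. -/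
def greedySet (w : Fin n → ℝ) : Set (Fin n) :=
  {i | i ∉ M.closure ∅ ∧ (M.threshold i (Finset.univ.erase i) w : ℝ) < w i}

variable {M}

/-- If elements heavier than `a` span a non-loop, the lightest of them witnesses a threshold above
`a`. Loops must be excluded, as the empty set spans them. -/
theorem notMem_closure_of_threshold_le {i : Fin n} {X : Finset (Fin n)} {w : Fin n → ℝ} {a : ℝ≥0}
    (hi : i ∉ M.closure ∅) (h : M.threshold i X w ≤ a) :
    i ∉ M.closure {k | k ∈ X ∧ (a : ℝ) < w k} := by
  classical
  intro hc
  have hne : (X.filter fun k => (a : ℝ) < w k).Nonempty := by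
    by_contra hne
    rw [Finset.not_nonempty_iff_eq_empty] at hne
    have : {k | k ∈ X ∧ (a : ℝ) < w k} = ∅ := by
      ext k
      have := congrArg (k ∈ ·) hne
      simpa using this
    exact hi (this ▸ hc)
  obtain ⟨j, hj, hmin⟩ := Finset.exists_min_image _ w hne
  rw [Finset.mem_filter] at hj
  have hcl : i ∈ M.closure {k | k ∈ X ∧ w j ≤ w k} := by
    refine M.closure_subset_closure ?_ hc
    rintro k ⟨h1, h2⟩
    exact ⟨h1, hmin k (Finset.mem_filter.2 ⟨h1, h2⟩)⟩
  have h1 := Finset.le_sup (f := fun j => if i ∈ M.closure {k | k ∈ X ∧ w j ≤ w k}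
    then (w j).toNNReal else 0) hj.1
  simp only [hcl, if_true] at h1
  have h2 : (w j).toNNReal ≤ a := h1.trans h
  rw [Real.toNNReal_le_iff_le_coe] at h2
  exact absurd hj.2 (not_lt.2 h2)

theorem threshold_mono {i : Fin n} {X Y : Finset (Fin n)} (h : X ⊆ Y) (w : Fin n → ℝ) :
    M.threshold i X w ≤ M.threshold i Y w := by
  classical
  refine Finset.sup_le fun j hj => ?_
  split_ifs with hc
  · have hcl : i ∈ M.closure {k | k ∈ Y ∧ w j ≤ w k} := by
      refine M.closure_subset_closure ?_ hc
      rintro k ⟨h1, h2⟩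
      exact ⟨h h1, h2⟩
    have h1 := Finset.le_sup (f := fun j => if i ∈ M.closure {k | k ∈ Y ∧ w j ≤ w k}
      then (w j).toNNReal else 0) (h hj)
    simp only [hcl, if_true] at h1
    exact h1
  · exact zero_le

theorem threshold_congr {i : Fin n} {X : Finset (Fin n)} {w w' : Fin n → ℝ}
    (h : ∀ j ∈ X, w j = w' j) : M.threshold i X w = M.threshold i X w' := by
  classical
  refine Finset.sup_congr rfl fun j hj => ?_
  have : {k | k ∈ X ∧ w j ≤ w k} = {k | k ∈ X ∧ w' j ≤ w' k} := by
    ext k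
    exact and_congr_right fun hk => by rw [h j hj, h k hk]
  rw [this, h j hj]

theorem threshold_update {i : Fin n} {X : Finset (Fin n)} (hi : i ∉ X) (w : Fin n → ℝ) (y : ℝ) :
    M.threshold i X (Function.update w i y) = M.threshold i X w :=
  threshold_congr fun j hj => Function.update_of_ne (by rintro rfl; exact hi hj) _ _

/-- Whether `i` is spanned depends only on the pattern of comparisons between weights, and there are
finitely many patterns. -/
theorem measurable_threshold (i : Fin n) (X : Finset (Fin n)) :
    Measurable (M.threshold i X) := by
  classical
  have h : ∀ j, Measurable fun w : Fin n → ℝ =>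
      if i ∈ M.closure {k | k ∈ X ∧ w j ≤ w k} then (w j).toNNReal else 0 := by
    intro j
    refine Measurable.ite ?_ (measurable_pi_apply j).real_toNNReal measurable_const
    have hm : Measurable fun (w : Fin n → ℝ) (k : Fin n) => w j ≤ w k :=
      measurable_pi_lambda _ fun k =>
        (measurableSet_le (measurable_pi_apply j) (measurable_pi_apply k)).mem
    exact hm (Set.toFinite {q : Fin n → Prop | i ∈ M.closure {k | k ∈ X ∧ q k}}).measurableSet
  have : M.threshold i X = X.sup fun j (w : Fin n → ℝ) =>
      if i ∈ M.closure {k | k ∈ X ∧ w j ≤ w k} then (w j).toNNReal else 0 := by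
    ext w
    rw [Finset.sup_apply]
    rfl
  rw [this]
  exact Finset.sup_induction (p := Measurable) measurable_const
    (fun _ hf _ hg => hf.sup hg) fun j _ => h j

/-- Take the heaviest element of `U` outside the span. It is not greedy, so it is spanned by
strictly heavier elements; these lie in `U` and, by maximality, in the span. Only this spanning
property of the greedy set is needed, not its independence. -/
theorem subset_closure_greedySet_inter (hM : M.E = Set.univ) {w : Fin n → ℝ}
    (hinj : Function.Injective w) {U : Set (Fin n)} (hpos : ∀ i ∈ U, 0 < w i)
    (hU : ∀ i j, i ∈ U → w i ≤ w j → j ∈ U) : U ⊆ M.closure (M.greedySet w ∩ U) := by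
  classical
  by_contra hcon
  rw [Set.not_subset] at hcon
  obtain ⟨i, hi, hmax⟩ := Finset.exists_max_image
    (Finset.univ.filter fun i => i ∈ U ∧ i ∉ M.closure (M.greedySet w ∩ U)) w
    (by obtain ⟨i, h1, h2⟩ := hcon; exact ⟨i, by simp [h1, h2]⟩)
  simp only [Finset.mem_filter, Finset.mem_univ, true_and] at hi hmax
  obtain ⟨hiU, hicl⟩ := hi
  have hl : i ∉ M.closure ∅ := fun h => hicl (M.closure_subset_closure (Set.empty_subset _) h)
  have hig : i ∉ M.greedySet w := fun h =>
    hicl (M.subset_closure _ (by simp [hM]) ⟨h, hiU⟩)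
  have hle : (w i).toNNReal ≤ M.threshold i (Finset.univ.erase i) w := by
    rw [Real.toNNReal_le_iff_le_coe]
    by_contra h
    exact hig ⟨hl, not_le.1 h⟩
  -- Positivity of `w i` makes some term of the supremum reach it, and rules out a term with the
  -- default value zero.
  rw [threshold, Finset.le_sup_iff (by simpa using hpos i hiU)] at hle
  obtain ⟨j, hj, hle⟩ := hle
  split_ifs at hle with hc
  · have hwij : w i ≤ w j := by
      by_contra h
      push Not at h
      exact absurd hle (not_le.2 ((Real.toNNReal_lt_toNNReal_iff (hpos i hiU)).2 h))
    refine hicl (M.closure_subset_closure_of_subset_closure ?_ hc)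
    rintro k ⟨hk, hjk⟩
    have hki : k ≠ i := by simpa using hk
    have hlt : w i < w k := lt_of_le_of_ne (hwij.trans hjk) fun h => hki (hinj h.symm)
    by_contra hkc
    exact absurd (hmax k ⟨hU i k hiU hlt.le, hkc⟩) (not_le.2 hlt)
  · exact absurd hle (by simpa using hpos i hiU)

theorem Indep.encard_inter_le_greedySet (hM : M.E = Set.univ) {w : Fin n → ℝ}
    (hinj : Function.Injective w) {U : Set (Fin n)} (hpos : ∀ i ∈ U, 0 < w i)
    (hU : ∀ i j, i ∈ U → w i ≤ w j → j ∈ U) {S : Set (Fin n)} (hS : M.Indep S) :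
    (S ∩ U).encard ≤ (M.greedySet w ∩ U).encard := by
  have h1 : M.Indep (S ∩ U) := hS.subset Set.inter_subset_left
  calc (S ∩ U).encard = M.eRk (S ∩ U) := h1.eRk_eq_encard.symm
    _ ≤ M.eRk (M.closure (M.greedySet w ∩ U)) :=
        M.eRk_mono (Set.inter_subset_right.trans (subset_closure_greedySet_inter hM hinj hpos hU))
    _ = M.eRk (M.greedySet w ∩ U) := M.eRk_closure_eq _
    _ ≤ _ := M.eRk_le_encard _

end Matroid

/-- A comparison of the sizes of all superlevel sets gives a comparison of weights. -/
theorem sum_indicator_le_of_encard_superlevel_le {ι : Type*} [Fintype ι] (W : ι → ℝ≥0)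
    (S G : Set ι) (h : ∀ a : ℝ≥0, (S ∩ {i | a < W i}).encard ≤ (G ∩ {i | a < W i}).encard) :
    ∑ i, S.indicator (fun i => (W i : ℝ≥0∞)) i ≤ ∑ i, G.indicator (fun i => (W i : ℝ≥0∞)) i := by
  classical
  -- Layer cake: a weight is the length of the set of levels below it.
  have key : ∀ T : Set ι, ∑ i, T.indicator (fun i => (W i : ℝ≥0∞)) i =
      ∫⁻ a in Set.Ici (0 : ℝ), ∑ i, (T ∩ {i | a < W i}).indicator (fun _ => (1 : ℝ≥0∞)) i := by
    intro T
    rw [lintegral_finsetSum']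
    · refine Finset.sum_congr rfl fun i _ => ?_
      by_cases hi : i ∈ T
      · have : ∀ a : ℝ, (T ∩ {i | a < W i}).indicator (fun _ => (1 : ℝ≥0∞)) i =
            (Set.Iio (W i : ℝ)).indicator 1 a := by
          intro a
          simp [Set.indicator, hi]
        simp only [this, hi, Set.indicator_of_mem]
        rw [lintegral_indicator_one measurableSet_Iio, Measure.restrict_apply measurableSet_Iio,
          Set.inter_comm, Set.Ici_inter_Iio, Real.volume_Ico]
        simp
      · simp [Set.indicator, hi]
    · intro i _
      refine Measurable.aemeasurable ?_
      by_cases hi : i ∈ T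
      · simp only [Set.indicator, Set.mem_inter_iff, hi, true_and, Set.mem_ofPred_eq]
        exact Measurable.ite measurableSet_Iio measurable_const measurable_const
      · simp [Set.indicator, hi]
  have hcard : ∀ T : Set ι, ∑ i, T.indicator (fun _ => (1 : ℝ≥0∞)) i = (T.encard : ℝ≥0∞) := by
    intro T
    rw [T.encard_eq_coe_toFinset_card]
    simp [Set.indicator]
  rw [key, key]
  refine setLIntegral_mono' measurableSet_Ici fun a ha => ?_
  rw [hcard, hcard]
  have := h ⟨a, ha⟩
  exact_mod_cast ENat.toENNReal_le.2 this

namespace Matroid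

variable {n : ℕ} {M : Matroid (Fin n)}

/-- The greedy set has maximal weight in the convex hull of the independent sets, for every
nonnegative weighting that is nondecreasing in `w`. -/
theorem sum_le_sum_greedySet (hM : M.E = Set.univ) {w : Fin n → ℝ}
    (hinj : Function.Injective w) (hpos : ∀ i, 0 < w i) {W : Fin n → ℝ} (hW : ∀ i, 0 ≤ W i)
    (hmono : ∀ i j, w i ≤ w j → W i ≤ W j) {y : Fin n → ℝ}
    (hy : y ∈ convexHull ℝ {y : Fin n → ℝ | ∃ S, M.Indep S ∧ y = S.indicator 1}) :
    ∑ i, y i * W i ≤ ∑ i, (M.greedySet w).indicator W i := by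
  classical
  have hind : ∀ S, M.Indep S → ∑ i, S.indicator W i ≤ ∑ i, (M.greedySet w).indicator W i := by
    intro S hS
    have h := sum_indicator_le_of_encard_superlevel_le (fun i => (W i).toNNReal) S
      (M.greedySet w) (fun a => hS.encard_inter_le_greedySet hM hinj (fun i _ => hpos i)
        fun i j hi hij => lt_of_lt_of_le hi (Real.toNNReal_le_toNNReal (hmono i j hij)))
    have hc : ∀ T : Set (Fin n), ∑ i, T.indicator (fun i => ((W i).toNNReal : ℝ≥0∞)) i =
        ENNReal.ofReal (∑ i, T.indicator W i) := by
      intro T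
      rw [ENNReal.ofReal_sum_of_nonneg fun i _ => Set.indicator_nonneg (fun i _ => hW i) i]
      refine Finset.sum_congr rfl fun i _ => ?_
      by_cases hi : i ∈ T <;> simp [hi, ENNReal.ofReal]
    rw [hc, hc, ENNReal.ofReal_le_ofReal_iff
      (Finset.sum_nonneg fun i _ => Set.indicator_nonneg (fun i _ => hW i) i)] at h
    exact h
  -- The bound is linear in `y`, so it passes from independent sets to randomizations over them.
  have hconv : Convex ℝ {y : Fin n → ℝ | ∑ i, y i * W i ≤ ∑ i, (M.greedySet w).indicator W i} := by
    refine convex_halfSpace_le (f := fun y : Fin n → ℝ => ∑ i, y i * W i) ⟨?_, ?_⟩ _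
    · intro a b
      simp [add_mul, Finset.sum_add_distrib]
    · intro c a
      simp [mul_assoc, Finset.mul_sum]
  refine convexHull_min ?_ hconv hy
  rintro _ ⟨S, hS, rfl⟩
  refine le_trans (le_of_eq (Finset.sum_congr rfl fun i _ => ?_)) (hind S hS)
  by_cases hi : i ∈ S <;> simp [hi]

theorem mem_Icc_of_mem_convexHull {y : Fin n → ℝ}
    (hy : y ∈ convexHull ℝ {y : Fin n → ℝ | ∃ S, M.Indep S ∧ y = S.indicator 1}) (i : Fin n) :
    0 ≤ y i ∧ y i ≤ 1 ∧ (i ∈ M.closure ∅ → y i = 0) := by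
  classical
  have hconv : Convex ℝ {y : Fin n → ℝ | y i ∈ if i ∈ M.closure ∅ then ({0} : Set ℝ) else
      Set.Icc 0 1} := by
    have : Convex ℝ (if i ∈ M.closure ∅ then ({0} : Set ℝ) else Set.Icc 0 1) := by
      split_ifs
      · exact convex_singleton 0
      · exact convex_Icc 0 1
    exact this.linear_preimage (LinearMap.proj (R := ℝ) (φ := fun _ : Fin n => ℝ) i)
  have h := convexHull_min (s := {y : Fin n → ℝ | ∃ S, M.Indep S ∧ y = S.indicator 1}) ?_ hconv hy
  · by_cases hi : i ∈ M.closure ∅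
    · simp [hi] at h
      simp [h]
    · simp [hi] at h
      simp [h, hi]
  · rintro _ ⟨S, hS, rfl⟩
    by_cases hi : i ∈ M.closure ∅
    · have : i ∉ S := fun h => by
        have h1 := hS.notMem_closure_sdiff_of_mem h
        exact h1 (M.closure_subset_closure (Set.empty_subset _) hi)
      simp [hi, this]
    · by_cases hS : i ∈ S <;> simp [hi, hS]

end Matroid

/-- Among the subsets not containing `i`, at least half are no worse than their complement. -/
theorem two_pow_le_card_filter_compl {n : ℕ} (i : Fin n) (τ : Finset (Fin n) → ℝ≥0) :
    (2 : ℝ≥0∞) ^ n ≤ 4 * (Finset.univ.filter fun A : Finset (Fin n) =>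
      i ∉ A ∧ τ (Finset.univ.erase i \ A) ≤ τ A).card := by
  classical
  set B := Finset.univ.filter fun A : Finset (Fin n) =>
      i ∉ A ∧ τ (Finset.univ.erase i \ A) ≤ τ A
  set C := B.image fun A => Finset.univ.erase i \ A
  -- Complementation among the bidders other than `i` reverses the comparison, so good sets and
  -- their complements cover all sets avoiding `i`.
  have h1 : (Finset.univ.erase i).powerset ⊆ B ∪ C := by
    intro A hA
    have hA' : A ⊆ Finset.univ.erase i := Finset.mem_powerset.1 hA
    have hi : i ∉ A := fun h => by simpa using hA' h
    have hcc : Finset.univ.erase i \ (Finset.univ.erase i \ A) = A := by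
      rw [Finset.sdiff_sdiff_eq_self hA']
    rcases le_total (τ (Finset.univ.erase i \ A)) (τ A) with h | h
    · exact Finset.mem_union_left _ (by simp [B, hi, h])
    · refine Finset.mem_union_right _ (Finset.mem_image.2 ⟨Finset.univ.erase i \ A, ?_, hcc⟩)
      simp only [B, Finset.mem_filter, hcc]
      simp [h]
  have h2 := (Finset.card_le_card h1).trans (Finset.card_union_le _ _)
  have h3 : C.card ≤ B.card := Finset.card_image_le
  rw [Finset.card_powerset, Finset.card_erase_of_mem (Finset.mem_univ _), Finset.card_univ,
    Fintype.card_fin] at h2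
  have hn : 0 < n := i.pos
  obtain ⟨m, rfl⟩ := Nat.exists_eq_succ_of_ne_zero hn.ne'
  have h4 : 2 ^ (m + 1) ≤ 4 * B.card := by
    rw [pow_succ]
    simp only [Nat.succ_eq_add_one, Nat.add_sub_cancel] at h2
    omega
  exact_mod_cast h4

/-! ### The mechanism -/

namespace SingleSampleSPM

variable {n : ℕ}

/-- A bidder does not precede itself in the order, so an online price ignores the bidder's own bid.
-/
theorem price_update (P : SingleSampleSPM n) (c : P.Coin) (s b : Fin n → ℝ) (i : Fin n) (t : ℝ) :
    P.price c s (Function.update b i t) i = P.price c s b i := by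
  have h := P.price_online c s (Function.update b i t) b ((P.order c s).symm i) (fun j hj => by
    refine Function.update_of_ne ?_ _ _
    rintro rfl
    simp at hj)
  simpa using h

theorem toMechanism_p_nonneg (P : SingleSampleSPM n) (c : P.Coin) (s b : Fin n → ℝ) (i : Fin n) :
    0 ≤ (P.toMechanism c s).p b i :=
  Set.indicator_nonneg (fun _ _ => ENNReal.toReal_nonneg) i

theorem utility_toMechanism (P : SingleSampleSPM n) (c : P.Coin) (s b : Fin n → ℝ) (i : Fin n)
    (t : ℝ) [Decidable (P.price c s b i < ENNReal.ofReal (b i))] :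
    (P.toMechanism c s).utility i t b =
      if P.price c s b i < ENNReal.ofReal (b i) then t - (P.price c s b i).toReal else 0 := by
  split_ifs with h
  · simp [Mechanism.utility, toMechanism, winners, h]
  · simp only [Mechanism.utility, toMechanism, winners]
    rw [Set.indicator_of_notMem (by simpa using h), Set.indicator_of_notMem (by simpa using h)]
    simp

/-- Each bidder faces a take-it-or-leave-it price independent of the own bid. A bid equal to the
price loses, which costs nothing since winning would give utility zero. -/
theorem truthful (P : SingleSampleSPM n) : P.Truthful := by
  classical
  have hlt : ∀ {p : ℝ≥0∞} {t : ℝ}, p < ENNReal.ofReal t → 0 ≤ t - p.toReal := by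
    intro p t h
    lift p to ℝ≥0 using h.ne_top
    have : (p : ℝ) < t := by
      by_contra hc
      exact absurd (ENNReal.ofReal_le_ofReal (not_lt.1 hc)) (by simpa using h)
    simpa using this.le
  have hge : ∀ {p : ℝ≥0∞} {t u : ℝ}, 0 ≤ t → ¬ p < ENNReal.ofReal t → p < ENNReal.ofReal u →
      t - p.toReal ≤ 0 := by
    intro p t u ht h h2
    have := ENNReal.toReal_mono h2.ne_top (not_lt.1 h)
    rw [ENNReal.toReal_ofReal ht] at this
    linarith
  refine fun c s => ⟨fun i t b ht _ => ?_, fun i t b ht _ => ?_⟩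
  · rw [utility_toMechanism, utility_toMechanism, price_update, Function.update_self]
    split_ifs with h1 h2 h2
    · exact le_rfl
    · exact hge ht h2 h1
    · exact hlt h2
    · exact le_rfl
  · rw [utility_toMechanism, price_update, Function.update_self]
    split_ifs with h1
    · exact hlt h1
    · exact le_rfl

end SingleSampleSPM

/-! ### Online greedy service and the sampling mechanism -/

namespace Matroid

variable {n : ℕ} (M : Matroid (Fin n))

open Classical in
/-- The set obtained after `k` steps when the elements satisfying `B` are added greedily in the
order `σ` as long as the set remains independent. -/
noncomputable def greedyPrefix (σ : Equiv.Perm (Fin n)) (B : Fin n → Prop) : ℕ → Finset (Fin n)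
  | 0 => ∅
  | k + 1 =>
    if h : k < n then
      if B (σ ⟨k, h⟩) ∧ M.Indep (insert (σ ⟨k, h⟩) (greedyPrefix σ B k : Set (Fin n))) then
        insert (σ ⟨k, h⟩) (greedyPrefix σ B k)
      else greedyPrefix σ B k
    else greedyPrefix σ B k

variable {M}

/-- The first `k` steps inspect only the first `k` elements; this is what makes the prices online.
-/
theorem greedyPrefix_congr {σ : Equiv.Perm (Fin n)} {B B' : Fin n → Prop} {k : ℕ}
    (h : ∀ j : Fin n, (j : ℕ) < k → (B (σ j) ↔ B' (σ j))) :
    M.greedyPrefix σ B k = M.greedyPrefix σ B' k := by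
  classical
  induction k with
  | zero => rfl
  | succ k ih =>
    rw [greedyPrefix, greedyPrefix, ih fun j hj => h j (hj.trans (Nat.lt_succ_self k))]
    by_cases hk : k < n
    · rw [dif_pos hk, dif_pos hk]
      exact if_congr (and_congr_left' (h ⟨k, hk⟩ (Nat.lt_succ_self k))) rfl rfl
    · simp [hk]

theorem indep_greedyPrefix (σ : Equiv.Perm (Fin n)) (B : Fin n → Prop) (k : ℕ) :
    M.Indep (M.greedyPrefix σ B k : Set (Fin n)) := by
  induction k with
  | zero => simp [greedyPrefix]
  | succ k ih =>
    rw [greedyPrefix]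
    split_ifs with h1 h2
    · simpa using h2.2
    · exact ih
    · exact ih

theorem mem_greedyPrefix {σ : Equiv.Perm (Fin n)} {B : Fin n → Prop} {k : ℕ} {j : Fin n}
    (hj : j ∈ M.greedyPrefix σ B k) : B j ∧ (σ.symm j : ℕ) < k := by
  induction k with
  | zero => simp [greedyPrefix] at hj
  | succ k ih =>
    rw [greedyPrefix] at hj
    split_ifs at hj with h1 h2
    · rcases Finset.mem_insert.1 hj with rfl | hj
      · exact ⟨h2.1, by simp⟩
      · exact ⟨(ih hj).1, (ih hj).2.trans (Nat.lt_succ_self k)⟩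
    · exact ⟨(ih hj).1, (ih hj).2.trans (Nat.lt_succ_self k)⟩
    · exact ⟨(ih hj).1, (ih hj).2.trans (Nat.lt_succ_self k)⟩

theorem greedyPrefix_mono (σ : Equiv.Perm (Fin n)) (B : Fin n → Prop) :
    Monotone (M.greedyPrefix σ B) := by
  refine monotone_nat_of_le_succ fun k => ?_
  rw [greedyPrefix]
  split_ifs
  · exact Finset.subset_insert _ _
  · exact le_rfl
  · exact le_rfl

theorem mem_greedyPrefix_card {σ : Equiv.Perm (Fin n)} {B : Fin n → Prop} {i : Fin n} (hB : B i)
    (hi : M.Indep (insert i (M.greedyPrefix σ B (σ.symm i) : Set (Fin n)))) :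
    i ∈ M.greedyPrefix σ B n := by
  refine greedyPrefix_mono σ B (Nat.succ_le_of_lt (σ.symm i).2) ?_
  rw [greedyPrefix, dif_pos (σ.symm i).2]
  rw [if_pos ⟨by simpa using hB, by simpa using hi⟩]
  simp

variable (M)

/-- The price of a bidder outside the sampled set `A` who can still be served: the larger one of
the threshold set by the sampled bidders and the bidder's own sample. -/
noncomputable def reservePrice (A : Finset (Fin n)) (s : Fin n → ℝ) (i : Fin n) : ℝ≥0 :=
  max (M.threshold i A s) (s i).toNNReal

/-- Bidders are served in the order of decreasing thresholds. -/
noncomputable def servingOrder (A : Finset (Fin n)) (s : Fin n → ℝ) : Equiv.Perm (Fin n) :=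
  Tuple.sort fun i => OrderDual.toDual (M.threshold i A s)

/-- The bidder is not sampled and the bid exceeds the reserve price. -/
def Bidding (A : Finset (Fin n)) (s b : Fin n → ℝ) (i : Fin n) : Prop :=
  i ∉ A ∧ (M.reservePrice A s i : ℝ≥0∞) < ENNReal.ofReal (b i)

/-- The bidders served before bidder `i`. -/
noncomputable def servedBefore (A : Finset (Fin n)) (s b : Fin n → ℝ) (i : Fin n) :
    Finset (Fin n) :=
  M.greedyPrefix (M.servingOrder A s) (M.Bidding A s b) ((M.servingOrder A s).symm i)

open Classical in
/-- The price offered to bidder `i`. -/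
noncomputable def samplePrice (A : Finset (Fin n)) (s b : Fin n → ℝ) (i : Fin n) : ℝ≥0∞ :=
  if i ∉ A ∧ M.Indep (insert i (M.servedBefore A s b i : Set (Fin n))) then M.reservePrice A s i
  else ⊤

theorem measurable_reservePrice (A : Finset (Fin n)) (i : Fin n) :
    Measurable fun s => M.reservePrice A s i :=
  (measurable_threshold i A).max (measurable_pi_apply i).real_toNNReal

theorem measurableSet_servingOrder_eq (A : Finset (Fin n)) (σ : Equiv.Perm (Fin n)) :
    MeasurableSet {s | M.servingOrder A s = σ} := by
  -- A sorting permutation is characterized by monotonicity together with tie-breaking by index.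
  have : {s | M.servingOrder A s = σ} =
      (⋂ j, ⋂ k, ⋂ _ : j ≤ k, {s | M.threshold (σ k) A s ≤ M.threshold (σ j) A s}) ∩
      ⋂ j, ⋂ k, ⋂ _ : j < k, {s | M.threshold (σ j) A s = M.threshold (σ k) A s → σ j < σ k} := by
    ext s
    simp only [Set.mem_ofPred_eq, servingOrder, eq_comm (b := σ), Tuple.eq_sort_iff, Set.mem_inter_iff,
      Set.mem_iInter]
    exact Iff.rfl
  rw [this]
  refine (MeasurableSet.iInter fun j => .iInter fun k => .iInter fun _ =>
    measurableSet_le (measurable_threshold _ A) (measurable_threshold _ A)).inter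
    (MeasurableSet.iInter fun j => .iInter fun k => .iInter fun _ => ?_)
  exact (measurableSet_eq_fun (measurable_threshold _ A) (measurable_threshold _ A)).imp (.const _)

theorem measurable_samplePrice (A : Finset (Fin n)) (i : Fin n) :
    Measurable fun q : (Fin n → ℝ) × (Fin n → ℝ) => M.samplePrice A q.1 q.2 i := by
  classical
  refine Measurable.ite ?_
    ((M.measurable_reservePrice A i).comp measurable_fst).coe_nnreal_ennreal measurable_const
  have hB : Measurable fun (q : (Fin n → ℝ) × (Fin n → ℝ)) (j : Fin n) => M.Bidding A q.1 q.2 j := by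
    refine measurable_pi_lambda _ fun j => MeasurableSet.mem ?_
    exact (MeasurableSet.const _).inter (measurableSet_lt
      ((M.measurable_reservePrice A j).comp measurable_fst).coe_nnreal_ennreal
      ((measurable_pi_apply j).comp measurable_snd).ennreal_ofReal)
  -- Split by the finitely many serving orders; for a fixed order the event depends only on which
  -- bidders are bidding.
  have : {q : (Fin n → ℝ) × (Fin n → ℝ) |
      i ∉ A ∧ M.Indep (insert i (M.servedBefore A q.1 q.2 i : Set (Fin n)))} =
      ⋃ σ : Equiv.Perm (Fin n), {q | M.servingOrder A q.1 = σ} ∩ {q | i ∉ A ∧ M.Indep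
        (insert i (M.greedyPrefix σ (M.Bidding A q.1 q.2) (σ.symm i) : Set (Fin n)))} := by
    ext q
    simp [servedBefore]
  rw [this]
  refine MeasurableSet.iUnion fun σ => .inter ?_ ?_
  · exact measurable_fst (M.measurableSet_servingOrder_eq A σ)
  · exact hB (Set.toFinite {B : Fin n → Prop |
      i ∉ A ∧ M.Indep (insert i (M.greedyPrefix σ B (σ.symm i) : Set (Fin n)))}).measurableSet

theorem samplePrice_congr (A : Finset (Fin n)) (s b b' : Fin n → ℝ) (k : Fin n)
    (h : ∀ j < k, b (M.servingOrder A s j) = b' (M.servingOrder A s j)) :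
    M.samplePrice A s b (M.servingOrder A s k) = M.samplePrice A s b' (M.servingOrder A s k) := by
  classical
  have : M.servedBefore A s b (M.servingOrder A s k) =
      M.servedBefore A s b' (M.servingOrder A s k) := by
    refine greedyPrefix_congr fun j hj => ?_
    rw [Bidding, Bidding, h j (by simpa using hj)]
  exact if_congr (by rw [this]) rfl rfl

/-- The single-sample mechanism of a matroid. Its coins choose a uniformly random set of bidders
who are never served and whose samples determine the thresholds of the other bidders. -/
noncomputable def sampleSPM : SingleSampleSPM n where
  Coin := Finset (Fin n)
  measurableSpaceCoin := ⊤
  coinLaw := @uniformOn _ ⊤ Set.univ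
  isProbabilityMeasure_coinLaw := by
    let _ : MeasurableSpace (Finset (Fin n)) := ⊤
    have : MeasurableSingletonClass (Finset (Fin n)) := ⟨fun _ => trivial⟩
    exact isProbabilityMeasure_uniformOn Set.finite_univ Set.univ_nonempty
  order := M.servingOrder
  price := M.samplePrice
  price_online := M.samplePrice_congr
  measurable_price i := by
    let _ : MeasurableSpace (Finset (Fin n)) := ⊤
    have : MeasurableSingletonClass (Finset (Fin n)) := ⟨fun _ => trivial⟩
    exact measurable_from_prod_countable_right fun A => M.measurable_samplePrice A i

/-- A winner was offered a finite price, hence bids above the reserve and fits with the bidders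
served before: the greedy run picks it too. -/
theorem feasible_sampleSPM : M.sampleSPM.Feasible M := by
  intro (A : Finset (Fin n)) s b
  refine (M.indep_greedyPrefix (M.servingOrder A s) (M.Bidding A s b) n).subset fun i hi => ?_
  change M.samplePrice A s b i < ENNReal.ofReal (b i) at hi
  unfold samplePrice at hi
  split_ifs at hi with h
  · exact mem_greedyPrefix_card ⟨h.1, hi⟩ h.2
  · simp at hi

variable {M}

/-- A bidder not spanned by the higher unsampled bids is offered the reserve price. -/
theorem samplePrice_eq_reservePrice (hM : M.E = Set.univ) {A : Finset (Fin n)} {s b : Fin n → ℝ}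
    {i : Fin n} (hA : i ∉ A)
    (hi : i ∉ M.closure {j | j ∈ Finset.univ.erase i \ A ∧ (M.threshold i A s : ℝ) < b j}) :
    M.samplePrice A s b i = M.reservePrice A s i := by
  have hind : M.Indep (M.servedBefore A s b i : Set (Fin n)) := indep_greedyPrefix _ _ _
  -- The reason for decreasing thresholds: bidders served earlier bid above their own threshold,
  -- which is at least that of `i`.
  have hsub : (M.servedBefore A s b i : Set (Fin n)) ⊆
      {j | j ∈ Finset.univ.erase i \ A ∧ (M.threshold i A s : ℝ) < b j} := by
    intro j hj
    obtain ⟨⟨hjA, hjb⟩, hlt⟩ := mem_greedyPrefix (Finset.mem_coe.1 hj)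
    have hlt' : (M.servingOrder A s).symm j < (M.servingOrder A s).symm i := hlt
    have hji : j ≠ i := by rintro rfl; exact lt_irrefl _ hlt
    have hT : M.threshold i A s ≤ M.threshold j A s := by
      have := Tuple.monotone_sort (fun i => OrderDual.toDual (M.threshold i A s)) hlt'.le
      simpa [servingOrder] using this
    have h1 : (M.threshold i A s : ℝ≥0∞) < ENNReal.ofReal (b j) :=
      lt_of_le_of_lt (by exact_mod_cast hT.trans (le_max_left _ _)) hjb
    refine ⟨by simp [hji, hjA], ?_⟩
    by_contra hc
    have h2 := ENNReal.ofReal_le_ofReal (not_lt.1 hc)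
    rw [ENNReal.ofReal_coe_nnreal] at h2
    exact absurd h1 (not_lt.2 h2)
  exact if_pos ⟨hA, insert_indep_iff.2
    ⟨hind, fun _ => ⟨by simp [hM], fun h => hi (M.closure_subset_closure hsub h)⟩⟩⟩

end Matroid

/-! ### Product measures -/

section ProductMeasures

variable {n : ℕ} (D : Fin n → Measure ℝ) [∀ i, IsProbabilityMeasure (D i)]

/-- Resampling one coordinate preserves a product law. This allows integrating over the value of one
bidder while keeping the index set. -/
theorem lintegral_pi_eq_lintegral_update (i : Fin n) {f : (Fin n → ℝ) → ℝ≥0∞} (hf : Measurable f) :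
    ∫⁻ x, f x ∂Measure.pi D = ∫⁻ x, ∫⁻ y, f (Function.update x i y) ∂D i ∂Measure.pi D := by
  have h : MeasurePreserving (fun q : (Fin n → ℝ) × ℝ => Function.update q.1 i q.2)
      ((Measure.pi D).prod (D i)) (Measure.pi D) := by
    have hm : Measurable fun q : (Fin n → ℝ) × ℝ => Function.update q.1 i q.2 := by
      refine measurable_pi_lambda _ fun j => ?_
      by_cases hj : j = i
      · subst hj
        simpa using measurable_snd
      · simp only [Function.update_of_ne hj]
        exact (measurable_pi_apply j).comp measurable_fst
    refine ⟨hm, (Measure.pi_eq fun s hs => ?_).symm⟩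
    rw [Measure.map_apply hm (MeasurableSet.univ_pi hs)]
    have : (fun q : (Fin n → ℝ) × ℝ => Function.update q.1 i q.2) ⁻¹' Set.univ.pi s =
        (Set.univ.pi (Function.update s i Set.univ)) ×ˢ s i := by
      ext q
      simp only [Set.mem_preimage, Set.mem_pi, Set.mem_univ, true_imp_iff, Set.mem_prod]
      constructor
      · refine fun h => ⟨fun j => ?_, by simpa using h i⟩
        by_cases hj : j = i
        · subst hj; simp
        · simpa [hj] using h j
      · rintro ⟨h1, h2⟩ j
        by_cases hj : j = i
        · subst hj; simpa using h2
        · simpa [hj] using h1 j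
    rw [this, Measure.prod_prod, Measure.pi_pi, ← Finset.prod_erase_mul _ _ (Finset.mem_univ i),
      ← Finset.prod_erase_mul _ (fun j => D j (s j)) (Finset.mem_univ i)]
    congr 1
    rw [Function.update_self, measure_univ, mul_one]
    refine Finset.prod_congr rfl fun j hj => ?_
    rw [Function.update_of_ne (Finset.ne_of_mem_erase hj)]
  rw [← h.lintegral_comp hf, lintegral_prod]
  exact (hf.comp h.measurable).aemeasurable

/-- Exchange the coordinates in `A` of a pair of vectors. -/
def swapOn (A : Finset (Fin n)) (q : (Fin n → ℝ) × (Fin n → ℝ)) : (Fin n → ℝ) × (Fin n → ℝ) :=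
  (fun j => if j ∈ A then q.2 j else q.1 j, fun j => if j ∈ A then q.1 j else q.2 j)

/-- As a vector of pairs, the law is a product of the symmetric laws `(D j).prod (D j)`, each
invariant under swapping. -/
theorem measurePreserving_swapOn (A : Finset (Fin n)) :
    MeasurePreserving (swapOn A) ((Measure.pi D).prod (Measure.pi D))
      ((Measure.pi D).prod (Measure.pi D)) := by
  have h1 := measurePreserving_arrowProdEquivProdArrow ℝ ℝ (Fin n) D D
  have h2 : MeasurePreserving
      (fun (a : Fin n → ℝ × ℝ) j => (if j ∈ A then Prod.swap else id) (a j))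
      (Measure.pi fun j => (D j).prod (D j)) (Measure.pi fun j => (D j).prod (D j)) := by
    refine measurePreserving_pi _ _ fun j => ?_
    split_ifs
    · exact Measure.measurePreserving_swap
    · exact MeasurePreserving.id _
  have h3 := (h1.comp h2).comp (h1.symm _)
  convert! h3 using 1
  ext q j
  · by_cases hj : j ∈ A <;>
      simp [swapOn, hj, MeasurableEquiv.arrowProdEquivProdArrow, Equiv.arrowProdEquivProdArrow]
  · by_cases hj : j ∈ A <;>
      simp [swapOn, hj, MeasurableEquiv.arrowProdEquivProdArrow, Equiv.arrowProdEquivProdArrow]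

theorem ae_pi_coord {i : Fin n} {p : ℝ → Prop} (h : ∀ᵐ y ∂D i, p y) :
    ∀ᵐ x ∂Measure.pi D, p (x i) :=
  (measurePreserving_eval D i).quasiMeasurePreserving.ae h

theorem ae_pi_injective [∀ i, NullSingletonClass (D i)] :
    ∀ᵐ x ∂Measure.pi D, Function.Injective x := by
  have h : ∀ i j : Fin n, i ≠ j → ∀ᵐ x ∂Measure.pi D, x i ≠ x j := by
    intro i j hij
    have hm : MeasurableSet {x : Fin n → ℝ | x i = x j} :=
      measurableSet_eq_fun (measurable_pi_apply i) (measurable_pi_apply j)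
    rw [ae_iff]
    simp only [ne_eq, not_not]
    rw [← lintegral_indicator_one hm,
      lintegral_pi_eq_lintegral_update D i (measurable_one.indicator hm)]
    refine lintegral_eq_zero_of_ae_eq_zero (Filter.Eventually.of_forall fun x => ?_)
    refine lintegral_eq_zero_of_ae_eq_zero ?_
    have h0 : ∀ᵐ y ∂D i, y ≠ x j := by
      rw [ae_iff]
      simp
    filter_upwards [h0] with y hy
    simp [Set.indicator, hij.symm, hy]
  have h' := ae_all_iff.2 fun i => ae_all_iff.2 fun j => ae_all_iff.2 (h i j)
  filter_upwards [h'] with x hx i j hij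
  by_contra hne
  exact hx i j hne hij

end ProductMeasures

/-! ### The contribution of a single bidder to the mechanism -/

namespace Matroid

variable {n : ℕ} {M : Matroid (Fin n)}

theorem lintegral_law_sampleSPM (D : Fin n → Measure ℝ) [∀ i, IsProbabilityMeasure (D i)]
    {f : M.sampleSPM.Coin × (Fin n → ℝ) × (Fin n → ℝ) → ℝ≥0∞} (hf : Measurable f) :
    ∫⁻ q, f q ∂M.sampleSPM.law D =
      (2 ^ n)⁻¹ * ∑ A : Finset (Fin n), ∫⁻ q, f (A, q) ∂((Measure.pi D).prod (Measure.pi D)) := by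
  rw [SingleSampleSPM.law, lintegral_prod _ hf.aemeasurable]
  let _ : MeasurableSpace (Finset (Fin n)) := ⊤
  have : MeasurableSingletonClass (Finset (Fin n)) := ⟨fun _ => trivial⟩
  change ∫⁻ A : Finset (Fin n), _ ∂(uniformOn Set.univ) = _
  rw [uniformOn, ProbabilityTheory.cond, lintegral_smul_measure, Measure.restrict_univ,
    lintegral_count, tsum_fintype]
  simp [Measure.count_apply]

/-- If bidder `i`, facing a price `max t s` with `t ≤ θ` and a sample `s`, contributes at least
`K θ` in expectation, then the mechanism extracts a quarter of the expected value of `K` at the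
threshold with respect to all other bidders. -/
theorem lintegral_threshold_le_sampleSPM (hM : M.E = Set.univ) (D : Fin n → Measure ℝ)
    [∀ i, IsProbabilityMeasure (D i)] {i : Fin n} (hi : i ∉ M.closure ∅)
    {g : ℝ≥0∞ × ℝ → ℝ≥0∞} (hg : Measurable g) {K : ℝ≥0 → ℝ≥0∞} (hKm : Measurable K)
    (hK : ∀ t θ : ℝ≥0, t ≤ θ → K θ ≤
      ∫⁻ v, ∫⁻ s, g (((max t s.toNNReal : ℝ≥0) : ℝ≥0∞), v) ∂D i ∂D i) :
    ∫⁻ v, K (M.threshold i (Finset.univ.erase i) v) ∂Measure.pi D ≤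
      4 * ∫⁻ q, g (M.sampleSPM.price q.1 q.2.1 q.2.2 i, q.2.2 i) ∂M.sampleSPM.law D := by
  classical
  have hgm : Measurable fun q : M.sampleSPM.Coin × (Fin n → ℝ) × (Fin n → ℝ) =>
      g (M.sampleSPM.price q.1 q.2.1 q.2.2 i, q.2.2 i) :=
    hg.comp ((M.sampleSPM.measurable_price i).prodMk
      ((measurable_pi_apply i).comp (measurable_snd.comp measurable_snd)))
  rw [lintegral_law_sampleSPM D hgm]
  set τ : (Fin n → ℝ) → Finset (Fin n) → ℝ≥0 := fun b A => M.threshold i A b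
  have hτm : ∀ A, Measurable fun b => τ b A := fun A => measurable_threshold i A
  set θ : (Fin n → ℝ) → ℝ≥0 := fun b => M.threshold i (Finset.univ.erase i) b
  -- The good event for the coin outcome `A`, read off a single vector; it does not depend on the
  -- coordinate `i`.
  set E : Finset (Fin n) → Set (Fin n → ℝ) := fun A => {b | i ∉ A ∧ τ b (Finset.univ.erase i \ A) ≤ τ b A}
  have hEm : ∀ A, MeasurableSet (E A) := by
    intro A
    have h : MeasurableSet {b | τ b (Finset.univ.erase i \ A) ≤ τ b A} :=
      measurableSet_le (hτm _) (hτm _)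
    exact (MeasurableSet.const (i ∉ A)).inter h
  have hKθ : Measurable fun b => K (θ b) := hKm.comp (measurable_threshold i _)
  have hstep : ∀ A : Finset (Fin n), ∫⁻ b, (E A).indicator (fun b => K (θ b)) b ∂Measure.pi D ≤
      ∫⁻ q : (Fin n → ℝ) × (Fin n → ℝ), g (M.sampleSPM.price A q.1 q.2 i, q.2 i)
        ∂((Measure.pi D).prod (Measure.pi D)) := by
    intro A
    by_cases hA : i ∈ A
    · simp [E, hA]
    -- The payoff on the good event as it occurs in the mechanism: the threshold of `A` comes from
    -- samples, that of the other bidders from bids.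
    set G : (Fin n → ℝ) × (Fin n → ℝ) → ℝ≥0∞ := fun q =>
      {q : (Fin n → ℝ) × (Fin n → ℝ) | τ q.2 (Finset.univ.erase i \ A) ≤ τ q.1 A}.indicator
        (fun q => g (((max (τ q.1 A) (q.1 i).toNNReal : ℝ≥0) : ℝ≥0∞), q.2 i)) q
    have hGm : Measurable G := by
      refine Measurable.indicator ?_ (measurableSet_le ((hτm _).comp measurable_snd)
        ((hτm _).comp measurable_fst))
      exact hg.comp ((((hτm A).comp measurable_fst).max
        ((measurable_pi_apply i).comp measurable_fst).real_toNNReal).coe_nnreal_ennreal.prodMk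
        ((measurable_pi_apply i).comp measurable_snd))
    -- The same payoff after the exchange: both thresholds come from `b`, and only the own sample
    -- `u` is separate.
    set H : (Fin n → ℝ) → ℝ → ℝ≥0∞ := fun b u => (E A).indicator
        (fun b => g (((max (τ b A) u.toNNReal : ℝ≥0) : ℝ≥0∞), b i)) b
    have hHm : Measurable fun q : (Fin n → ℝ) × ℝ => H q.1 q.2 := by
      have : (fun q : (Fin n → ℝ) × ℝ => H q.1 q.2) = (Prod.fst ⁻¹' E A).indicator
        (fun q => g (((max (τ q.1 A) q.2.toNNReal : ℝ≥0) : ℝ≥0∞), q.1 i)) := by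
        ext q
        simp [H, Set.indicator]
      rw [this]
      refine Measurable.indicator ?_ (measurable_fst (hEm A))
      exact hg.comp ((((hτm A).comp measurable_fst).max
        measurable_snd.real_toNNReal).coe_nnreal_ennreal.prodMk
        ((measurable_pi_apply i).comp measurable_fst))
    calc ∫⁻ b, (E A).indicator (fun b => K (θ b)) b ∂Measure.pi D
        ≤ ∫⁻ b, ∫⁻ v, ∫⁻ u, H (Function.update b i v) u ∂D i ∂D i ∂Measure.pi D := by
          refine lintegral_mono fun b => ?_
          by_cases hb : b ∈ E A
          · have hb' : ∀ v, Function.update b i v ∈ E A := by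
              intro v
              refine ⟨hA, ?_⟩
              simp only [τ]
              rw [threshold_update (by simp), threshold_update hA]
              exact hb.2
            have hτ : ∀ v, τ (Function.update b i v) A = τ b A := fun v => threshold_update hA _ _
            simp only [H, Set.indicator_of_mem hb, Set.indicator_of_mem (hb' _), hτ,
              Function.update_self]
            refine hK (τ b A) (θ b) (threshold_mono (fun j hj => ?_) b)
            have : j ≠ i := by rintro rfl; exact hA hj
            simp [this]
          · simp [Set.indicator_of_notMem hb]
      _ = ∫⁻ b, ∫⁻ u, H b u ∂D i ∂Measure.pi D :=
          (lintegral_pi_eq_lintegral_update D i hHm.lintegral_prod_right').symm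
      _ = ∫⁻ b, ∫⁻ s, H b (s i) ∂Measure.pi D ∂Measure.pi D := by
          refine lintegral_congr fun b => ?_
          exact ((measurePreserving_eval D i).lintegral_comp
            (hHm.comp (measurable_const.prodMk measurable_id))).symm
      _ = ∫⁻ q, G (swapOn A q) ∂((Measure.pi D).prod (Measure.pi D)) := by
          rw [lintegral_prod_symm' (fun q => G (swapOn A q)) (hGm.comp (measurePreserving_swapOn D A).measurable)]
          refine lintegral_congr fun b => lintegral_congr fun s => ?_
          have h1 : τ (swapOn A (s, b)).1 A = τ b A :=
            threshold_congr fun j hj => by simp [swapOn, hj]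
          have h2 : τ (swapOn A (s, b)).2 (Finset.univ.erase i \ A) =
              τ b (Finset.univ.erase i \ A) :=
            threshold_congr fun j hj => by simp [swapOn, (Finset.mem_sdiff.1 hj).2]
          have h3 : (swapOn A (s, b)).1 i = s i := by simp [swapOn, hA]
          have h4 : (swapOn A (s, b)).2 i = b i := by simp [swapOn, hA]
          simp only [G, H, E, Set.indicator, Set.mem_ofPred_eq, h1, h2, h3, h4, hA,
            not_false_eq_true, true_and]
      _ = ∫⁻ q, G q ∂((Measure.pi D).prod (Measure.pi D)) :=
          (measurePreserving_swapOn D A).lintegral_comp hGm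
      _ ≤ _ := by
          refine lintegral_mono fun q => ?_
          refine Set.indicator_apply_le' (fun hq => ?_) fun _ => zero_le
          have := samplePrice_eq_reservePrice hM (s := q.1) (b := q.2) hA
            (notMem_closure_of_threshold_le hi hq)
          change _ ≤ g (M.samplePrice A q.1 q.2 i, q.2 i)
          rw [this]
          exact le_rfl
  calc ∫⁻ v, K (θ v) ∂Measure.pi D
      ≤ ∫⁻ v, 4 * ((2 ^ n)⁻¹ * ∑ A, (E A).indicator (fun b => K (θ b)) v) ∂Measure.pi D := by
        refine lintegral_mono fun b => ?_
        -- For each fixed vector, at least a quarter of the coin outcomes are good.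
        have h1 := two_pow_le_card_filter_compl i (τ b)
        have h2 : ∑ A, (E A).indicator (fun b => K (θ b)) b =
            (Finset.univ.filter fun A : Finset (Fin n) =>
              i ∉ A ∧ τ b (Finset.univ.erase i \ A) ≤ τ b A).card * K (θ b) := by
          simp only [Set.indicator, E, Set.mem_ofPred_eq]
          rw [← Finset.sum_filter, Finset.sum_const, nsmul_eq_mul]
        rw [h2]
        calc K (θ b) = (2 ^ n)⁻¹ * 2 ^ n * K (θ b) := by
              rw [ENNReal.inv_mul_cancel (by simp) (by simp), one_mul]
          _ ≤ (2 ^ n)⁻¹ * (4 * (Finset.univ.filter fun A : Finset (Fin n) =>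
              i ∉ A ∧ τ b (Finset.univ.erase i \ A) ≤ τ b A).card) * K (θ b) := by gcongr
          _ = _ := by ring
    _ = 4 * ((2 ^ n)⁻¹ * ∑ A, ∫⁻ v, (E A).indicator (fun b => K (θ b)) v ∂Measure.pi D) := by
        have hm : ∀ A, Measurable fun v => (E A).indicator (fun b => K (θ b)) v :=
          fun A => hKθ.indicator (hEm A)
        rw [lintegral_const_mul, lintegral_const_mul, lintegral_finsetSum]
        · exact fun A _ => hm A
        · exact Finset.measurable_sum _ fun A _ => hm A
        · exact (Finset.measurable_sum _ fun A _ => hm A).const_mul _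
    _ ≤ _ := by
        gcongr with A
        exact hstep A

end Matroid

/-! ### Expected payoff of a single posted price -/

/-- The welfare of offering the price `q.1` to a bidder of value `q.2`. -/
noncomputable def postedWelfare (q : ℝ≥0∞ × ℝ) : ℝ≥0∞ :=
  if q.1 < ENNReal.ofReal q.2 then ENNReal.ofReal q.2 else 0

/-- The revenue of offering the price `q.1` to a bidder of value `q.2`. -/
noncomputable def postedRevenue (q : ℝ≥0∞ × ℝ) : ℝ≥0∞ :=
  if q.1 < ENNReal.ofReal q.2 then q.1 else 0

theorem measurableSet_fst_lt_ofReal_snd :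
    MeasurableSet {q : ℝ≥0∞ × ℝ | q.1 < ENNReal.ofReal q.2} :=
  measurableSet_lt measurable_fst measurable_snd.ennreal_ofReal

theorem measurable_postedWelfare : Measurable postedWelfare :=
  Measurable.ite measurableSet_fst_lt_ofReal_snd measurable_snd.ennreal_ofReal measurable_const

theorem measurable_postedRevenue : Measurable postedRevenue :=
  Measurable.ite measurableSet_fst_lt_ofReal_snd measurable_fst measurable_const

theorem coe_nnreal_lt_ofReal {p : ℝ≥0} {v : ℝ} : (p : ℝ≥0∞) < ENNReal.ofReal v ↔ (p : ℝ) < v := by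
  rw [← ENNReal.ofReal_coe_nnreal, ENNReal.ofReal_lt_ofReal_iff']
  exact ⟨fun h => h.1, fun h => ⟨h, lt_of_le_of_lt p.2 h⟩⟩

section OneBidder

variable {D : Measure ℝ} [IsProbabilityMeasure D]

/-- Two independent draws from one atomless law are exchangeable and almost surely distinct, so a
bound may be charged to either ordering of the pair. -/
theorem lintegral_le_two_mul_of_le_add_swap [NullSingletonClass D] {F h : ℝ → ℝ → ℝ≥0∞}
    (hm : Measurable (Function.uncurry h)) (hF : ∀ v s, s ≠ v → F v s ≤ h v s + h s v) :
    ∫⁻ v, ∫⁻ s, F v s ∂D ∂D ≤ 2 * ∫⁻ v, ∫⁻ s, h v s ∂D ∂D := by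
  have hm' : Measurable (Function.uncurry fun s v => h v s) := hm.comp measurable_swap
  calc ∫⁻ v, ∫⁻ s, F v s ∂D ∂D ≤ ∫⁻ v, ∫⁻ s, (h v s + h s v) ∂D ∂D := by
        refine lintegral_mono fun v => lintegral_mono_ae ?_
        have : ∀ᵐ s ∂D, s ≠ v := by
          rw [ae_iff]; simp
        filter_upwards [this] with s hs using hF v s hs
    _ = ∫⁻ v, ∫⁻ s, h v s ∂D ∂D + ∫⁻ v, ∫⁻ s, h s v ∂D ∂D := by
        rw [← lintegral_add_left hm.lintegral_prod_right]
        exact lintegral_congr fun v => lintegral_add_left (hm.comp measurable_prodMk_left) _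
    _ = _ := by
        rw [lintegral_lintegral_swap (f := fun v s => h s v) hm'.aemeasurable, two_mul]

theorem measurable_posted_max {g : ℝ≥0∞ × ℝ → ℝ≥0∞} (hg : Measurable g) (t : ℝ≥0) :
    Measurable (Function.uncurry fun v s : ℝ => g (((max t s.toNNReal : ℝ≥0) : ℝ≥0∞), v)) :=
  hg.comp ((measurable_const.max measurable_snd.real_toNNReal).coe_nnreal_ennreal.prodMk
    measurable_fst)

/-- If `v` exceeds `θ`, the larger of `v` and `s` is worth at least `v` and beats both `t` and the
smaller one; charge `v` to that ordering of the pair. -/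
theorem lintegral_Ioi_le_postedWelfare [NullSingletonClass D] {t θ : ℝ≥0} (h : t ≤ θ) :
    ∫⁻ v in Set.Ioi (θ : ℝ), ENNReal.ofReal v ∂D ≤
      2 * ∫⁻ v, ∫⁻ s, postedWelfare (((max t s.toNNReal : ℝ≥0) : ℝ≥0∞), v) ∂D ∂D := by
  have hF := lintegral_le_two_mul_of_le_add_swap (D := D)
    (F := fun v _ => (Set.Ioi (θ : ℝ)).indicator (fun v => ENNReal.ofReal v) v)
    (measurable_posted_max measurable_postedWelfare t) (fun v s hs => ?_)
  · refine le_trans (le_of_eq ?_) hF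
    rw [← lintegral_indicator measurableSet_Ioi]
    simp
  · refine Set.indicator_apply_le' (fun hv => ?_) fun _ => zero_le
    have hθ : (θ : ℝ) < v := hv
    have htv : (t : ℝ) < v := lt_of_le_of_lt (by exact_mod_cast h) hθ
    have hv0 : 0 < v := lt_of_le_of_lt t.2 htv
    simp only [postedWelfare, coe_nnreal_lt_ofReal, NNReal.coe_max, Real.coe_toNNReal',
      max_lt_iff]
    rcases lt_or_gt_of_ne hs with hs | hs
    · simp [hs, htv, hv0]
    · simp only [htv.trans hs, hs, hv0.trans hs, and_self, if_true]
      exact le_add_left (ENNReal.ofReal_le_ofReal hs.le)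

/-- The tail hypothesis says that `v / 2` is stochastically dominated by the minimum of two draws.
The quantity `t` on `v > t`, plus the excess of `min s v` over `t`, is covered by the revenue from
the two orderings, which costs 2; replacing `v` by `2 * (t + (v / 2 - t)⁺)` costs another 2. -/
theorem lintegral_Ioi_le_postedRevenue [NullSingletonClass D]
    (hD : ∀ x, 0 ≤ x → D (Set.Ioi (2 * x)) ≤ D (Set.Ioi x) ^ 2) {t θ : ℝ≥0} (h : t ≤ θ) :
    ∫⁻ v in Set.Ioi (θ : ℝ), ENNReal.ofReal v ∂D ≤
      4 * ∫⁻ v, ∫⁻ s, postedRevenue (((max t s.toNNReal : ℝ≥0) : ℝ≥0∞), v) ∂D ∂D := by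
  have hF := lintegral_le_two_mul_of_le_add_swap (D := D)
    (F := fun v s => (Set.Ioi (t : ℝ)).indicator (fun _ => (t : ℝ≥0∞)) v +
      ENNReal.ofReal (min s v - t))
    (measurable_posted_max measurable_postedRevenue t) (fun v s hs => ?_)
  · have hmin : ∫⁻ v, ENNReal.ofReal (v / 2 - t) ∂D ≤
        ∫⁻ v, ∫⁻ s, ENNReal.ofReal (min s v - t) ∂D ∂D := by
      have hm : Measurable fun q : ℝ × ℝ => max (min q.2 q.1 - t) 0 := by fun_prop
      have e1 : ∫⁻ v, ∫⁻ s, ENNReal.ofReal (min s v - t) ∂D ∂D =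
          ∫⁻ q, ENNReal.ofReal (max (min q.2 q.1 - t) 0) ∂(D.prod D) := by
        rw [lintegral_prod _ hm.ennreal_ofReal.aemeasurable]
        simp
      have e2 : ∫⁻ v, ENNReal.ofReal (v / 2 - t) ∂D =
          ∫⁻ v, ENNReal.ofReal (max (v / 2 - t) 0) ∂D := by simp
      rw [e1, e2, lintegral_eq_lintegral_meas_lt (f := fun q : ℝ × ℝ => max (min q.2 q.1 - t) 0) _
        (Filter.Eventually.of_forall fun _ => le_max_right _ _) hm.aemeasurable,
        lintegral_eq_lintegral_meas_lt (f := fun v : ℝ => max (v / 2 - t) 0) _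
        (Filter.Eventually.of_forall fun _ => le_max_right _ _)
        (by fun_prop : Measurable fun v : ℝ => max (v / 2 - t) 0).aemeasurable]
      -- Tails are compared level by level: the event for the minimum factors into a square, to
      -- which `hD` applies at `t + x`.
      refine setLIntegral_mono' measurableSet_Ioi fun x hx => ?_
      have hx0 : 0 < x := hx
      have s1 : {a : ℝ | x < max (a / 2 - t) 0} = Set.Ioi (2 * (t + x)) := by
        ext a
        simp only [Set.mem_ofPred_eq, lt_max_iff, Set.mem_Ioi, not_lt.2 hx0.le, or_false]
        constructor <;> intro <;> linarith
      have s2 : {q : ℝ × ℝ | x < max (min q.2 q.1 - t) 0} =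
          Set.Ioi (t + x) ×ˢ Set.Ioi (t + x) := by
        ext q
        simp only [Set.mem_ofPred_eq, lt_max_iff, Set.mem_prod, Set.mem_Ioi, not_lt.2 hx0.le,
          or_false, lt_sub_iff_add_lt, lt_min_iff, add_comm x]
        exact and_comm
      rw [s1, s2, Measure.prod_prod, ← pow_two]
      exact hD _ (by positivity)
    have hadd : ∫⁻ v, (Set.Ioi (t : ℝ)).indicator (fun _ => (t : ℝ≥0∞)) v ∂D +
        ∫⁻ v, ENNReal.ofReal (v / 2 - t) ∂D ≤
        2 * ∫⁻ v, ∫⁻ s, postedRevenue (((max t s.toNNReal : ℝ≥0) : ℝ≥0∞), v) ∂D ∂D := by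
      refine le_trans (add_le_add le_rfl hmin) (le_trans (le_of_eq ?_) hF)
      rw [← lintegral_add_left (measurable_const.indicator measurableSet_Ioi)]
      refine lintegral_congr fun v => ?_
      rw [lintegral_add_left measurable_const]
      simp
    calc ∫⁻ v in Set.Ioi (θ : ℝ), ENNReal.ofReal v ∂D
        ≤ ∫⁻ v, 2 * ((Set.Ioi (t : ℝ)).indicator (fun _ => (t : ℝ≥0∞)) v +
            ENNReal.ofReal (v / 2 - t)) ∂D := by
          rw [← lintegral_indicator measurableSet_Ioi]
          refine lintegral_mono fun v => ?_
          refine Set.indicator_apply_le' (fun hv => ?_) fun _ => zero_le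
          have htv : (t : ℝ) < v := lt_of_le_of_lt (by exact_mod_cast h) hv
          rw [Set.indicator_of_mem (show v ∈ Set.Ioi (t : ℝ) from htv), ← ENNReal.ofReal_coe_nnreal]
          calc ENNReal.ofReal v ≤ ENNReal.ofReal (2 * (t + max (v / 2 - t) 0)) := by
                refine ENNReal.ofReal_le_ofReal ?_
                have := le_max_left (v / 2 - t) 0
                linarith
            _ = _ := by
                rw [ENNReal.ofReal_mul (by norm_num), ENNReal.ofReal_add t.coe_nonneg (le_max_right _ _)]
                simp
      _ = 2 * (∫⁻ v, (Set.Ioi (t : ℝ)).indicator (fun _ => (t : ℝ≥0∞)) v ∂D +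
            ∫⁻ v, ENNReal.ofReal (v / 2 - t) ∂D) := by
          rw [← lintegral_add_left (measurable_const.indicator measurableSet_Ioi),
            lintegral_const_mul]
          exact (measurable_const.indicator measurableSet_Ioi).add (by fun_prop)
      _ ≤ 2 * (2 * ∫⁻ v, ∫⁻ s, postedRevenue (((max t s.toNNReal : ℝ≥0) : ℝ≥0∞), v) ∂D ∂D) := by
          gcongr
      _ = _ := by
          rw [← mul_assoc]
          norm_num
  · by_cases htv : (t : ℝ) < v
    · have hv0 : 0 < v := lt_of_le_of_lt t.2 htv
      rw [Set.indicator_of_mem (show v ∈ Set.Ioi (t : ℝ) from htv)]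
      have hcoe : ∀ x : ℝ, (t : ℝ≥0∞) + ENNReal.ofReal (x - t) =
          ((max t x.toNNReal : ℝ≥0) : ℝ≥0∞) := by
        intro x
        rw [← ENNReal.ofReal_coe_nnreal, ← ENNReal.ofReal_coe_nnreal]
        rw [show ENNReal.ofReal (x - t) = ENNReal.ofReal (max (x - t) 0) by simp,
          ← ENNReal.ofReal_add t.coe_nonneg (le_max_right _ _)]
        congr 1
        simp only [NNReal.coe_max, Real.coe_toNNReal']
        have ht := t.coe_nonneg
        clear hD
        grind
      simp only [postedRevenue, coe_nnreal_lt_ofReal]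
      simp only [NNReal.coe_max, Real.coe_toNNReal', max_lt_iff]
      rcases lt_or_gt_of_ne hs with hs | hs
      · simp only [hs, htv, hv0, and_self, if_true, min_eq_left hs.le, hcoe]
        exact le_self_add
      · simp only [htv.trans hs, hs, hv0.trans hs, and_self, if_true, min_eq_right hs.le, hcoe]
        exact le_add_self
    · rw [Set.indicator_of_notMem (show v ∉ Set.Ioi (t : ℝ) from htv),
        ENNReal.ofReal_of_nonpos (by have := min_le_right s v; linarith)]
      simp

theorem lintegral_lintegral_postedRevenue (t : ℝ≥0) :
    ∫⁻ v, ∫⁻ s, postedRevenue (((max t s.toNNReal : ℝ≥0) : ℝ≥0∞), v) ∂D ∂D =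
      ∫⁻ s, ((max t s.toNNReal : ℝ≥0) : ℝ≥0∞) * D (Set.Ioi (max t s.toNNReal : ℝ≥0)) ∂D := by
  rw [lintegral_lintegral_swap (measurable_posted_max measurable_postedRevenue t).aemeasurable]
  refine lintegral_congr fun s => ?_
  rw [← setLIntegral_const, ← lintegral_indicator measurableSet_Ioi]
  refine lintegral_congr fun v => ?_
  simp only [postedRevenue, coe_nnreal_lt_ofReal, Set.indicator, Set.mem_Ioi]

/-- For a distribution with the stated property of the revenue curve, a random price drawn from
the distribution itself but at least `t` extracts half of the revenue of any price `y ≥ t`. -/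
theorem mul_Ioi_le_postedRevenue [NullSingletonClass D] (hpos : D (Set.Iio 0) = 0)
    {t y : ℝ≥0} (hty : t ≤ y)
    (hD : ∀ s : ℝ≥0, s ≤ y → (y : ℝ≥0∞) * D (Set.Ioi (y : ℝ)) * D (Set.Iic (s : ℝ)) ≤
      s * D (Set.Ioi (s : ℝ)) * D (Set.Iic (y : ℝ))) :
    (y : ℝ≥0∞) * D (Set.Ioi (y : ℝ)) ≤
      2 * ∫⁻ v, ∫⁻ s, postedRevenue (((max t s.toNNReal : ℝ≥0) : ℝ≥0∞), v) ∂D ∂D := by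
  rw [lintegral_lintegral_postedRevenue]
  set R : ℝ → ℝ≥0∞ := fun s =>
    ((max t s.toNNReal : ℝ≥0) : ℝ≥0∞) * D (Set.Ioi (max t s.toNNReal : ℝ≥0))
  have hnn : ∀ᵐ s ∂D, 0 ≤ s := by
    rw [ae_iff]
    simpa [Set.Iio] using hpos
  have hcomp : D (Set.Ioi (y : ℝ)) + D (Set.Iic (y : ℝ)) = 1 := by
    rw [← Set.compl_Iic, add_comm, prob_add_prob_compl measurableSet_Iic]
  have mIoi : Measurable fun s : ℝ => D (Set.Ioi s) :=
    (show Antitone fun s : ℝ => D (Set.Ioi s) from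
      fun a b hab => measure_mono (Set.Ioi_subset_Ioi hab)).measurable
  have mIic : Measurable fun s : ℝ => D (Set.Iic s) :=
    (show Monotone fun s : ℝ => D (Set.Iic s) from
      fun a b hab => measure_mono (Set.Iic_subset_Iic.2 hab)).measurable
  -- Two draws both land above `y`, and by symmetry each is the smaller one half of the time. `hb`
  -- is the mirror image below `y`.
  have ha : D (Set.Ioi (y : ℝ)) ^ 2 ≤ 2 * ∫⁻ s in Set.Ici (y : ℝ), D (Set.Ioi s) ∂D := by
    have := lintegral_le_two_mul_of_le_add_swap (D := D)
      (F := fun v s => (Set.Ioi (y : ℝ)).indicator 1 v * (Set.Ioi (y : ℝ)).indicator 1 s)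
      (h := fun v s => {q : ℝ × ℝ | y ≤ q.1 ∧ q.1 < q.2}.indicator 1 (v, s))
      (measurable_one.indicator ((measurableSet_le measurable_const measurable_fst).inter
        (measurableSet_lt measurable_fst measurable_snd))) (fun v s hs => by
          simp only [Set.indicator, Set.mem_Ioi, Set.mem_ofPred_eq, Pi.one_apply]
          rcases lt_or_gt_of_ne hs with hs | hs <;> by_cases h1 : (y : ℝ) < v <;>
            by_cases h2 : (y : ℝ) < s <;> first | simp [h1, h2, h1.le, h2.le, hs] | simp [h1, h2])
    refine le_trans (le_of_eq ?_) (this.trans (le_of_eq ?_))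
    · simp only [Set.indicator_apply]
      simp_rw [← Set.indicator_apply]
      have hmi : Measurable ((Set.Ioi (y : ℝ)).indicator (1 : ℝ → ℝ≥0∞)) :=
        measurable_one.indicator measurableSet_Ioi
      simp_rw [lintegral_const_mul _ hmi, lintegral_mul_const _ hmi]
      rw [lintegral_indicator_one measurableSet_Ioi, pow_two]
    · congr 1
      rw [← lintegral_indicator measurableSet_Ici]
      refine lintegral_congr fun v => ?_
      by_cases hv : (y : ℝ) ≤ v
      · rw [Set.indicator_of_mem (show v ∈ Set.Ici (y : ℝ) from hv),
          ← lintegral_indicator_one measurableSet_Ioi]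
        refine lintegral_congr fun s => ?_
        simp [Set.indicator, hv]
      · simp [Set.indicator, hv]
  have hb : D (Set.Iic (y : ℝ)) ^ 2 ≤ 2 * ∫⁻ s in Set.Iio (y : ℝ), D (Set.Iic s) ∂D := by
    have := lintegral_le_two_mul_of_le_add_swap (D := D)
      (F := fun v s => (Set.Iio (y : ℝ)).indicator 1 v * (Set.Iio (y : ℝ)).indicator 1 s)
      (h := fun v s => {q : ℝ × ℝ | q.1 < y ∧ q.2 ≤ q.1}.indicator 1 (v, s))
      (measurable_one.indicator ((measurableSet_lt measurable_fst measurable_const).inter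
        (measurableSet_le measurable_snd measurable_fst))) (fun v s hs => by
          simp only [Set.indicator, Set.mem_Iio, Set.mem_ofPred_eq, Pi.one_apply]
          rcases lt_or_gt_of_ne hs with hs | hs <;> by_cases h1 : v < (y : ℝ) <;>
            by_cases h2 : s < (y : ℝ) <;> simp [h1, h2, hs.le])
    refine le_trans (le_of_eq ?_) (this.trans (le_of_eq ?_))
    · have hmi : Measurable ((Set.Iio (y : ℝ)).indicator (1 : ℝ → ℝ≥0∞)) :=
        measurable_one.indicator measurableSet_Iio
      simp_rw [lintegral_const_mul _ hmi, lintegral_mul_const _ hmi]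
      rw [lintegral_indicator_one measurableSet_Iio, pow_two, measure_congr Iio_ae_eq_Iic]
    · congr 1
      rw [← lintegral_indicator measurableSet_Iio]
      refine lintegral_congr fun v => ?_
      by_cases hv : v < (y : ℝ)
      · rw [Set.indicator_of_mem (show v ∈ Set.Iio (y : ℝ) from hv),
          ← lintegral_indicator_one measurableSet_Iic]
        refine lintegral_congr fun s => ?_
        simp [Set.indicator, hv]
      · simp [Set.indicator, hv]
  -- A sample `s ≥ y` is itself the price, and earns at least `y` times its sale probability.
  have hR1 : y * ∫⁻ s in Set.Ici (y : ℝ), D (Set.Ioi s) ∂D ≤ ∫⁻ s in Set.Ici (y : ℝ), R s ∂D := by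
    rw [← lintegral_const_mul _ mIoi]
    refine setLIntegral_mono' measurableSet_Ici fun s hs => ?_
    have hys : y ≤ s.toNNReal := by
      rw [← Real.toNNReal_coe (r := y)]
      exact Real.toNNReal_le_toNNReal hs
    have hs0 : (0 : ℝ) ≤ s := le_trans y.2 hs
    simp only [R, max_eq_right (hty.trans hys), Real.coe_toNNReal _ hs0]
    gcongr
  -- For `s < y` the price is at most `y`, so the chord bound `hD` applies at `max t s`. The factor
  -- `D (Iic y)` is carried along to avoid a division.
  have hR2 : y * D (Set.Ioi (y : ℝ)) * ∫⁻ s in Set.Iio (y : ℝ), D (Set.Iic s) ∂D ≤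
      (∫⁻ s in Set.Iio (y : ℝ), R s ∂D) * D (Set.Iic (y : ℝ)) := by
    rw [← lintegral_const_mul _ mIic]
    rw [← lintegral_mul_const' _ _ (measure_ne_top _ _)]
    refine lintegral_mono_ae ?_
    filter_upwards [ae_restrict_of_ae hnn, ae_restrict_mem measurableSet_Iio] with s hs0 hsy
    have hsy' : s.toNNReal ≤ y := by
      rw [← Real.toNNReal_coe (r := y)]
      exact Real.toNNReal_le_toNNReal (le_of_lt hsy)
    refine le_trans ?_ (hD _ (max_le hty hsy'))
    gcongr
    calc s = ((s.toNNReal : ℝ≥0) : ℝ) := (Real.coe_toNNReal _ hs0).symm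
      _ ≤ _ := by exact_mod_cast le_max_right _ _
  have hsplit : ∫⁻ s, R s ∂D = ∫⁻ s in Set.Ici (y : ℝ), R s ∂D + ∫⁻ s in Set.Iio (y : ℝ), R s ∂D := by
    rw [← lintegral_add_compl R measurableSet_Ici, Set.compl_Ici]
  set G := D (Set.Ioi (y : ℝ))
  set F := D (Set.Iic (y : ℝ))
  have hJ : (y : ℝ≥0∞) * G * F ≤ 2 * ∫⁻ s in Set.Iio (y : ℝ), R s ∂D := by
    by_cases hF0 : F = 0
    · simp [hF0]
    · have hFt : F ≠ ⊤ := measure_ne_top _ _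
      refine (ENNReal.mul_le_mul_iff_left hF0 hFt).1 ?_
      calc (y : ℝ≥0∞) * G * F * F = y * G * F ^ 2 := by ring
        _ ≤ y * G * (2 * ∫⁻ s in Set.Iio (y : ℝ), D (Set.Iic s) ∂D) := by gcongr
        _ = 2 * (y * G * ∫⁻ s in Set.Iio (y : ℝ), D (Set.Iic s) ∂D) := by ring
        _ ≤ 2 * ((∫⁻ s in Set.Iio (y : ℝ), R s ∂D) * F) := by gcongr
        _ = _ := by ring
  -- The samples above `y` account for the share `G` of the target, those below for the share `F`.
  calc (y : ℝ≥0∞) * G = y * G * (G + F) := by rw [hcomp, mul_one]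
    _ = y * G ^ 2 + y * G * F := by ring
    _ ≤ y * (2 * ∫⁻ s in Set.Ici (y : ℝ), D (Set.Ioi s) ∂D) +
        2 * ∫⁻ s in Set.Iio (y : ℝ), R s ∂D := by gcongr
    _ = 2 * (y * ∫⁻ s in Set.Ici (y : ℝ), D (Set.Ioi s) ∂D) +
        2 * ∫⁻ s in Set.Iio (y : ℝ), R s ∂D := by ring
    _ ≤ 2 * ∫⁻ s in Set.Ici (y : ℝ), R s ∂D + 2 * ∫⁻ s in Set.Iio (y : ℝ), R s ∂D := by gcongr
    _ = _ := by rw [hsplit, mul_add]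

end OneBidder

/-! ### Distributions with a density -/

namespace IsPdf

variable {f : ℝ → ℝ} {D : Measure ℝ}

theorem nullSingletonClass (hf : IsPdf f D) : NullSingletonClass D := by
  rw [hf.eq_withDensity]
  infer_instance

theorem measure_apply (hf : IsPdf f D) {s : Set ℝ} (hs : MeasurableSet s) :
    D s = ∫⁻ v in s, ENNReal.ofReal (f v) := by
  rw [hf.eq_withDensity, withDensity_apply _ hs]

variable [IsProbabilityMeasure D]

theorem integrable (hf : IsPdf f D) : Integrable f volume := by
  refine ⟨hf.measurable.aestronglyMeasurable, ?_⟩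
  rw [hasFiniteIntegral_iff_ofReal (Filter.Eventually.of_forall hf.nonneg)]
  have : D Set.univ = ∫⁻ v, ENNReal.ofReal (f v) := by
    rw [hf.eq_withDensity, withDensity_apply _ MeasurableSet.univ, Measure.restrict_univ]
  rw [← this]
  exact measure_lt_top _ _

theorem real_apply (hf : IsPdf f D) {s : Set ℝ} (hs : MeasurableSet s) :
    D.real s = ∫ v in s, f v := by
  rw [measureReal_def, hf.measure_apply hs, ← ofReal_integral_eq_lintegral_ofReal
    hf.integrable.integrableOn (Filter.Eventually.of_forall hf.nonneg),
    ENNReal.toReal_ofReal (integral_nonneg hf.nonneg)]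

end IsPdf

section Survival

variable (D : Measure ℝ)

/-- The probability that the value exceeds `x`. -/
noncomputable def survival (x : ℝ) : ℝ := D.real (Set.Ioi x)

variable {D}

theorem survival_nonneg (x : ℝ) : 0 ≤ survival D x := measureReal_nonneg

variable [IsProbabilityMeasure D]

theorem ofReal_survival (x : ℝ) : ENNReal.ofReal (survival D x) = D (Set.Ioi x) :=
  ofReal_measureReal

theorem one_sub_cdf (x : ℝ) : 1 - cdf D x = survival D x := by
  rw [cdf_eq_real, survival, ← Set.compl_Iic, probReal_compl_eq_one_sub measurableSet_Iic]

theorem survival_antitone : Antitone (survival D) := fun _ _ h =>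
  measureReal_mono (Set.Ioi_subset_Ioi h)

theorem measurable_survival : Measurable (survival D) := survival_antitone.measurable

theorem survival_zero [NullSingletonClass D] (h : D (Set.Iio 0) = 0) : survival D 0 = 1 := by
  have h0 : D.real (Set.Iic 0) = 0 := by
    rw [measureReal_congr Iio_ae_eq_Iic.symm, measureReal_def, h, ENNReal.toReal_zero]
  rw [survival, ← Set.compl_Iic, probReal_compl_eq_one_sub measurableSet_Iic, h0, sub_zero]

end Survival

namespace IsPdf

variable {f : ℝ → ℝ} {D : Measure ℝ} [IsProbabilityMeasure D]

theorem survival_sub_survival (hf : IsPdf f D) {y z : ℝ} (hyz : y ≤ z) :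
    survival D y - survival D z = ∫ x in y..z, f x := by
  rw [survival, survival, hf.real_apply measurableSet_Ioi, hf.real_apply measurableSet_Ioi,
    intervalIntegral.integral_of_le hyz, ← Set.Ioc_union_Ioi_eq_Ioi hyz,
    setIntegral_union Set.Ioc_disjoint_Ioi_same measurableSet_Ioi hf.integrable.integrableOn
      hf.integrable.integrableOn]
  ring

theorem intervalIntegrable_mul_sub (hf : IsPdf f D) {φ φ' : ℝ → ℝ} (hφ : Continuous φ)
    (hφ' : Continuous φ') (y z : ℝ) :
    IntervalIntegrable (fun x => φ x * f x - φ' x * survival D x) volume y z := by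
  have h1 : IntervalIntegrable f volume y z := hf.integrable.intervalIntegrable
  have h2 : IntervalIntegrable (survival D) volume y z := survival_antitone.intervalIntegrable
  exact (h1.continuousOn_mul hφ.continuousOn).sub (h2.continuousOn_mul hφ'.continuousOn)

/-- Integration by parts against the distribution. -/
theorem integral_mul_sub (hf : IsPdf f D) {φ φ' : ℝ → ℝ} (hφ : ∀ x, HasDerivAt φ (φ' x) x)
    (hφ' : Continuous φ') {y z : ℝ} (hyz : y ≤ z) :
    ∫ x in y..z, (φ x * f x - φ' x * survival D x) =
      φ y * survival D y - φ z * survival D z := by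
  have hφc : Continuous φ := continuous_iff_continuousAt.2 fun x => (hφ x).continuousAt
  have hd : deriv φ = φ' := funext fun x => (hφ x).deriv
  have hfi : IntervalIntegrable f volume y z := hf.integrable.intervalIntegrable
  have hac : AbsolutelyContinuousOnInterval φ y z := by
    refine ContDiffOn.absolutelyContinuousOnInterval (ContDiff.contDiffOn ?_)
    rw [contDiff_one_iff_deriv, hd]
    exact ⟨fun x => (hφ x).differentiableAt, hφ'⟩
  -- The primitive of `f` is differentiable only almost everywhere, so the parts formula is used in
  -- its absolutely continuous form.
  have hP := hfi.absolutelyContinuousOnInterval_intervalIntegral (c := y) (by simp)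
  have hpart := hac.integral_deriv_mul_eq_sub hP
  have hftc : ∫ x in y..z, φ' x = φ z - φ y :=
    intervalIntegral.integral_eq_sub_of_hasDerivAt (fun x _ => hφ x) (hφ'.intervalIntegrable _ _)
  have hPz := hf.survival_sub_survival hyz
  have hφi : IntervalIntegrable φ' volume y z := hφ'.intervalIntegrable _ _
  calc ∫ x in y..z, (φ x * f x - φ' x * survival D x)
      = ∫ x in y..z, ((deriv φ x * (∫ v in y..x, f v) +
          φ x * deriv (fun x => ∫ v in y..x, f v) x) - φ' x * survival D y) := by
        refine intervalIntegral.integral_congr_ae ?_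
        filter_upwards [hfi.ae_hasDerivAt_integral] with x hx hxm
        rw [(hx (Set.uIoc_subset_uIcc hxm) y (by simp)).deriv, hd]
        rw [Set.uIoc_of_le hyz] at hxm
        rw [← hf.survival_sub_survival hxm.1.le]
        ring
    _ = _ := by
        rw [intervalIntegral.integral_sub, hpart, intervalIntegral.integral_mul_const, hftc,
          ← hPz, intervalIntegral.integral_same]
        · ring
        · exact (hac.intervalIntegrable_deriv.mul_continuousOn hP.continuousOn).add
            (hP.intervalIntegrable_deriv.continuousOn_mul hac.continuousOn)
        · exact hφi.mul_const _

/-- A monotone hazard rate makes the survival function at `2 x` at most the square of that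
at `x`. -/
theorem measure_Ioi_two_mul_le (hf : IsPdf f D) (h0 : D (Set.Iio 0) = 0)
    (hmhr : MonotoneOn (hazardRate f D) {v | 0 ≤ v ∧ cdf D v < 1}) {x : ℝ} (hx : 0 ≤ x) :
    D (Set.Ioi (2 * x)) ≤ D (Set.Ioi x) ^ 2 := by
  have := hf.nullSingletonClass
  have hmem : ∀ v, 0 ≤ v → 0 < survival D v → v ∈ {v | 0 ≤ v ∧ cdf D v < 1} := by
    intro v hv h
    rw [← one_sub_cdf] at h
    exact ⟨hv, by linarith⟩
  rw [← ofReal_survival, ← ofReal_survival, ← ENNReal.ofReal_pow (survival_nonneg _)]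
  refine ENNReal.ofReal_le_ofReal ?_
  rcases (survival_nonneg (D := D) (2 * x)).eq_or_lt with h2 | h2
  · rw [← h2]
    positivity
  have h1 : 0 < survival D x := h2.trans_le (survival_antitone (by linarith))
  -- Compare with the exponential law of rate `lam`: `exp (lam * u) * survival D u` has derivative
  -- of the sign of `lam` minus the hazard rate, so it rises up to `x` and falls afterwards.
  set lam := hazardRate f D x with hlam
  have hder : ∀ u : ℝ, HasDerivAt (fun u => Real.exp (lam * u)) (Real.exp (lam * u) * lam) u := by
    intro u
    have := ((hasDerivAt_id u).const_mul lam).exp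
    simpa using this
  have hcont : Continuous fun u : ℝ => Real.exp (lam * u) := by fun_prop
  have hcont' : Continuous fun u : ℝ => Real.exp (lam * u) * lam := by fun_prop
  have hhaz : ∀ u, 0 < survival D u → f u = hazardRate f D u * survival D u := by
    intro u hu
    rw [hazardRate, one_sub_cdf, div_mul_cancel₀ _ hu.ne']
  have hlow := hf.integral_mul_sub hder hcont' hx
  have hupp := hf.integral_mul_sub hder hcont' (show x ≤ 2 * x by linarith)
  have e1 : ∫ u in (0 : ℝ)..x,
      (Real.exp (lam * u) * f u - Real.exp (lam * u) * lam * survival D u) ≤ 0 := by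
    rw [intervalIntegral.integral_of_le hx]
    refine setIntegral_nonpos measurableSet_Ioc fun u hu => ?_
    have hsu : 0 < survival D u := h1.trans_le (survival_antitone hu.2)
    have := hmhr (hmem u hu.1.le hsu) (hmem x hx h1) hu.2
    rw [hhaz u hsu]
    have h3 := mul_le_mul_of_nonneg_right this
      (mul_nonneg (Real.exp_pos (lam * u)).le (survival_nonneg (D := D) u))
    linarith
  have e2 : 0 ≤ ∫ u in x..(2 * x),
      (Real.exp (lam * u) * f u - Real.exp (lam * u) * lam * survival D u) := by
    rw [intervalIntegral.integral_of_le (by linarith)]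
    refine setIntegral_nonneg measurableSet_Ioc fun u hu => ?_
    have hsu : 0 < survival D u := h2.trans_le (survival_antitone hu.2)
    have := hmhr (hmem x hx h1) (hmem u (hx.trans hu.1.le) hsu) hu.1.le
    rw [hhaz u hsu]
    have h3 := mul_le_mul_of_nonneg_right this
      (mul_nonneg (Real.exp_pos (lam * u)).le (survival_nonneg (D := D) u))
    linarith
  rw [hlow] at e1
  rw [hupp] at e2
  rw [survival_zero h0] at e1
  simp only [mul_zero, Real.exp_zero, mul_one] at e1
  have hexp : Real.exp (lam * (2 * x)) = Real.exp (lam * x) * Real.exp (lam * x) := by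
    rw [← Real.exp_add]; ring_nf
  rw [hexp] at e2
  set E := Real.exp (lam * x)
  have hE : 0 < E := Real.exp_pos _
  have e3 : E * survival D (2 * x) ≤ survival D x := by
    have : E * (E * survival D (2 * x)) ≤ E * survival D x := by linarith
    exact le_of_mul_le_mul_left this hE
  nlinarith [mul_le_mul_of_nonneg_right e3 h1.le, survival_nonneg (D := D) (2 * x)]

end IsPdf

/-! ### Regular distributions -/

namespace IsPdf

variable {f : ℝ → ℝ} {D : Measure ℝ} [IsProbabilityMeasure D]

theorem integral_revenue_rate (hf : IsPdf f D) (c : ℝ) {y z : ℝ} (hyz : y ≤ z) :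
    ∫ x in y..z, ((x - c) * f x - survival D x) =
      (y - c) * survival D y - (z - c) * survival D z := by
  have := hf.integral_mul_sub (φ := fun x => x - c) (φ' := fun _ => 1)
    (fun x => (hasDerivAt_id x).sub_const c) continuous_const hyz
  simpa using this

/-- Clearing the denominator absorbs the convention `-∞` at zeros of the density, where both sides
hold. -/
theorem virtualValue_le_coe_iff {v c : ℝ} (hf : 0 ≤ f v) (hv : 0 < survival D v) :
    virtualValue f D v ≤ c ↔ (v - c) * f v - survival D v ≤ 0 := by
  rw [virtualValue]
  split_ifs with h
  · simp [h, hv.le]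
  · have hpos : 0 < f v := lt_of_le_of_ne hf (Ne.symm h)
    rw [EReal.coe_le_coe_iff, one_sub_cdf, sub_le_comm, le_div_iff₀ hpos, sub_nonpos]

theorem mem_of_survival_pos {v : ℝ} (hv : 0 ≤ v) (h : 0 < survival D v) :
    v ∈ {v | 0 ≤ v ∧ cdf D v < 1} := by
  rw [← one_sub_cdf] at h
  exact ⟨hv, by linarith⟩

/-- The odds of the value not exceeding `s`, divided by `s`, are nondecreasing. -/
theorem survival_mul_le_of_regular (hf : IsPdf f D) (h0 : D (Set.Iio 0) = 0)
    (hreg : MonotoneOn (virtualValue f D) {v | 0 ≤ v ∧ cdf D v < 1}) {s y : ℝ} (hs : 0 ≤ s)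
    (hsy : s ≤ y) :
    y * survival D y * (1 - survival D s) ≤ s * survival D s * (1 - survival D y) := by
  have := hf.nullSingletonClass
  have hle1 : ∀ x, survival D x ≤ 1 := fun x => measureReal_le_one
  rcases (survival_nonneg (D := D) y).eq_or_lt with hy | hy
  · rw [← hy]
    have := mul_nonneg hs (survival_nonneg (D := D) s)
    simpa
  have hGs : 0 < survival D s := hy.trans_le (survival_antitone hsy)
  have hmem : ∀ u, 0 ≤ u → u ≤ y → u ∈ {v | 0 ≤ v ∧ cdf D v < 1} := fun u hu huy =>
    mem_of_survival_pos hu (hy.trans_le (survival_antitone huy))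
  -- A virtual value `-∞` at `s` forces `-∞` on all of `(0, s]`, so there is no mass below `s`.
  by_cases hfs : f s = 0
  · have hzero : ∀ u ∈ Set.Ioc 0 s, f u = 0 := by
      intro u hu
      have hmono := hreg (hmem u hu.1.le (hu.2.trans hsy)) (hmem s hs hsy) hu.2
      rw [virtualValue, virtualValue, if_pos hfs] at hmono
      by_contra hne
      rw [if_neg hne] at hmono
      exact EReal.coe_ne_bot _ (le_bot_iff.1 hmono)
    have hint := hf.survival_sub_survival hs
    rw [intervalIntegral.integral_of_le hs, setIntegral_congr_fun measurableSet_Ioc hzero,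
      survival_zero h0] at hint
    simp only [integral_zero] at hint
    rw [hint, mul_zero]
    exact mul_nonneg (mul_nonneg hs hGs.le) (by linarith [hle1 y])
  have hfpos : 0 < f s := lt_of_le_of_ne (hf.nonneg s) (Ne.symm hfs)
  -- For a seller with unit cost `c`, the virtual value at `s`, the profit `(u - c) * survival D u`
  -- rises up to `s` and falls afterwards. The integrals `e1` and `e2` compare its value at `s` with
  -- those at `0` and `y`.
  set c := s - survival D s / f s with hc
  have hcs : virtualValue f D s = c := by
    rw [virtualValue, if_neg hfs, one_sub_cdf]
  have hd : 0 < s - c := by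
    rw [hc]
    have := div_pos hGs hfpos
    linarith
  have e1 : ∫ u in (0 : ℝ)..s, ((u - c) * f u - survival D u) ≤ 0 := by
    rw [intervalIntegral.integral_of_le hs]
    refine setIntegral_nonpos measurableSet_Ioc fun u hu => ?_
    have hmono := hreg (hmem u hu.1.le (hu.2.trans hsy)) (hmem s hs hsy) hu.2
    rw [hcs] at hmono
    exact (virtualValue_le_coe_iff (hf.nonneg u)
      (hGs.trans_le (survival_antitone hu.2))).1 hmono
  have e2 : 0 ≤ ∫ u in s..y, ((u - c) * f u - survival D u) := by
    rw [intervalIntegral.integral_of_le hsy]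
    refine setIntegral_nonneg measurableSet_Ioc fun u hu => ?_
    have hu0 : 0 < survival D u := hy.trans_le (survival_antitone hu.2)
    have hmono := hreg (hmem s hs hsy) (hmem u (hs.trans hu.1.le) hu.2) hu.1.le
    rw [hcs, virtualValue] at hmono
    split_ifs at hmono with hfu
    · simp at hmono
    · have hpos : 0 < f u := lt_of_le_of_ne (hf.nonneg u) (Ne.symm hfu)
      rw [EReal.coe_le_coe_iff, one_sub_cdf, le_sub_comm, div_le_iff₀ hpos] at hmono
      linarith
  rw [hf.integral_revenue_rate c hs, survival_zero h0] at e1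
  rw [hf.integral_revenue_rate c hsy] at e2
  set a := survival D s
  set b := survival D y
  -- the line through the points `c` and `s` supports `1 / survival` at `s`
  have h3 : 0 ≤ (y - s) * (b * ((s - c) * a + c)) :=
    mul_nonneg (by linarith) (mul_nonneg hy.le (by linarith))
  have h4 := mul_nonneg (mul_nonneg hs hGs.le) (by linarith : 0 ≤ (s - c) * a - (y - c) * b)
  refine le_of_mul_le_mul_left ?_ hd
  nlinarith

end IsPdf

/-! ### Virtual values and the revenue of posted prices -/

/-- The positive part of the virtual value (zero where the density vanishes). -/
noncomputable def virtualPart (f : ℝ → ℝ) (D : Measure ℝ) (v : ℝ) : ℝ :=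
  if f v = 0 then 0 else max (v - survival D v / f v) 0

/-- The limiting revenue of very high posted prices. -/
noncomputable def revenueAtTop (D : Measure ℝ) : ℝ≥0∞ :=
  Filter.liminf (fun z : ℝ => ENNReal.ofReal (z * survival D z)) Filter.atTop

theorem virtualPart_nonneg (f : ℝ → ℝ) (D : Measure ℝ) (v : ℝ) : 0 ≤ virtualPart f D v := by
  rw [virtualPart]
  split_ifs
  · exact le_rfl
  · exact le_max_right _ _

namespace IsPdf

variable {f : ℝ → ℝ} {D : Measure ℝ} [IsProbabilityMeasure D]

theorem measurable_virtualPart (hf : IsPdf f D) : Measurable (virtualPart f D) :=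
  Measurable.ite (hf.measurable (measurableSet_singleton 0)) measurable_const
    ((measurable_id.sub (measurable_survival.div hf.measurable)).max measurable_const)

theorem monotoneOn_virtualPart
    (hreg : MonotoneOn (virtualValue f D) {v | 0 ≤ v ∧ cdf D v < 1}) :
    MonotoneOn (virtualPart f D) {v | 0 ≤ v ∧ cdf D v < 1} := by
  intro u hu v hv huv
  have h := hreg hu hv huv
  by_cases hfu : f u = 0
  · rw [virtualPart, if_pos hfu]
    exact virtualPart_nonneg _ _ _
  · by_cases hfv : f v = 0
    · rw [virtualValue, virtualValue, if_neg hfu, if_pos hfv] at h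
      exact absurd (le_bot_iff.1 h) (EReal.coe_ne_bot _)
    · rw [virtualValue, virtualValue, if_neg hfu, if_neg hfv, EReal.coe_le_coe_iff,
        one_sub_cdf, one_sub_cdf] at h
      rw [virtualPart, virtualPart, if_neg hfu, if_neg hfv]
      exact max_le_max h le_rfl

/-- Density times virtual value is `v * f v - survival D v`, minus the derivative of the revenue
curve almost everywhere. Where `f` vanishes this is nonpositive and is truncated to zero, matching
the convention. -/
theorem setLIntegral_virtualPart (hf : IsPdf f D) {s : Set ℝ} (hs : MeasurableSet s) :
    ∫⁻ v in s, ENNReal.ofReal (virtualPart f D v) ∂D =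
      ∫⁻ v in s, ENNReal.ofReal (v * f v - survival D v) := by
  have key : ∀ g : ℝ → ℝ≥0∞, Measurable g →
      ∫⁻ v in s, g v ∂D = ∫⁻ v in s, ENNReal.ofReal (f v) * g v := by
    intro g hg
    rw [hf.eq_withDensity, restrict_withDensity hs,
      lintegral_withDensity_eq_lintegral_mul _ hf.measurable.ennreal_ofReal hg]
    rfl
  rw [key _ hf.measurable_virtualPart.ennreal_ofReal]
  refine lintegral_congr fun v => ?_
  rw [← ENNReal.ofReal_mul (hf.nonneg v), virtualPart]
  split_ifs with h
  · rw [h, mul_zero, mul_zero, ENNReal.ofReal_of_nonpos]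
    · simpa using survival_nonneg v
    · simp
  · have hpos : 0 < f v := lt_of_le_of_ne (hf.nonneg v) (Ne.symm h)
    rw [mul_max_of_nonneg _ _ hpos.le, mul_zero, mul_sub, mul_div_cancel₀ _ h, mul_comm (f v)]
    simp

theorem intervalIntegrable_revenue_rate (hf : IsPdf f D) (y z : ℝ) :
    IntervalIntegrable (fun x => x * f x - survival D x) volume y z := by
  have := hf.intervalIntegrable_mul_sub (φ := fun x => x) (φ' := fun _ => 1) continuous_id
    continuous_const y z
  simpa using this

theorem integral_revenue_rate_zero (hf : IsPdf f D) {y z : ℝ} (hyz : y ≤ z) :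
    ∫ x in y..z, (x * f x - survival D x) = y * survival D y - z * survival D z := by
  simpa using hf.integral_revenue_rate 0 hyz

/-- The revenue of a posted price is at most the expected virtual value above it, up to the
revenue of a higher price. -/
theorem ofReal_revenue_le (hf : IsPdf f D) {τ z : ℝ} (hz : 0 ≤ z) (hτz : τ ≤ z) :
    ENNReal.ofReal (τ * survival D τ) ≤
      ∫⁻ v in Set.Ioi τ, ENNReal.ofReal (virtualPart f D v) ∂D +
        ENNReal.ofReal (z * survival D z) := by
  have hint := (hf.intervalIntegrable_revenue_rate τ z).1
  have h1 : τ * survival D τ = (∫ x in Set.Ioc τ z, (x * f x - survival D x)) +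
      z * survival D z := by
    rw [← intervalIntegral.integral_of_le hτz, hf.integral_revenue_rate_zero hτz]
    ring
  have h2 : ∫ x in Set.Ioc τ z, (x * f x - survival D x) ≤
      ∫ x in Set.Ioc τ z, max (x * f x - survival D x) 0 :=
    integral_mono hint (hint.pos_part) fun x => le_max_left _ _
  rw [hf.setLIntegral_virtualPart measurableSet_Ioi]
  calc ENNReal.ofReal (τ * survival D τ)
      ≤ ENNReal.ofReal ((∫ x in Set.Ioc τ z, max (x * f x - survival D x) 0) +
          z * survival D z) := ENNReal.ofReal_le_ofReal (by linarith)
    _ = ENNReal.ofReal (∫ x in Set.Ioc τ z, max (x * f x - survival D x) 0) +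
          ENNReal.ofReal (z * survival D z) :=
        ENNReal.ofReal_add (integral_nonneg fun x => le_max_right _ _)
          (mul_nonneg hz (survival_nonneg _))
    _ ≤ _ := by
        gcongr
        rw [ofReal_integral_eq_lintegral_ofReal hint.pos_part
          (Filter.Eventually.of_forall fun x => le_max_right _ _)]
        exact (lintegral_congr fun x => by simp).trans_le
          (lintegral_mono_set Set.Ioc_subset_Ioi_self)

/-- Regularity makes the virtual value change sign at most once. With `a` the crossing point in `[θ,
z]`, nothing is collected below `a`, and above `a` the integral telescopes to a difference of
revenues. -/
theorem exists_lintegral_virtualPart_le (hf : IsPdf f D)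
    (hreg : MonotoneOn (virtualValue f D) {v | 0 ≤ v ∧ cdf D v < 1}) {θ z : ℝ} (hθ : 0 ≤ θ)
    (hθz : θ ≤ z) :
    ∃ a, θ ≤ a ∧ ∫⁻ v in Set.Ioc θ z, ENNReal.ofReal (virtualPart f D v) ∂D +
      ENNReal.ofReal (z * survival D z) ≤ ENNReal.ofReal (a * survival D a) := by
  set k : ℝ → ℝ := fun v => v * f v - survival D v
  -- Inserting `θ` covers the case of no sign change. Survival must be positive because regularity
  -- says nothing elsewhere; where it vanishes, `k` is nonnegative anyway.
  set Z : Set ℝ := insert θ {v | v ∈ Set.Icc θ z ∧ 0 < survival D v ∧ k v ≤ 0}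
  have hZ : Z ⊆ Set.Icc θ z := by
    rintro v (rfl | hv)
    · exact ⟨le_rfl, hθz⟩
    · exact hv.1
  have hbdd : BddAbove Z := ⟨z, fun v hv => (hZ hv).2⟩
  have hne : Z.Nonempty := ⟨θ, Set.mem_insert _ _⟩
  set a := sSup Z
  have hθa : θ ≤ a := le_csSup hbdd (Set.mem_insert _ _)
  have haz : a ≤ z := csSup_le hne fun v hv => (hZ hv).2
  refine ⟨a, hθa, ?_⟩
  have hlow : ∀ v ∈ Set.Ioo θ a, k v ≤ 0 := by
    intro v hv
    obtain ⟨w, hw, hvw⟩ := exists_lt_of_lt_csSup hne hv.2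
    rcases hw with rfl | ⟨hwm, hws, hwk⟩
    · exact absurd hv.1 (not_lt.2 hvw.le)
    · have hv0 : 0 ≤ v := hθ.trans hv.1.le
      have hvs : 0 < survival D v := hws.trans_le (survival_antitone hvw.le)
      have hw0 : virtualValue f D w ≤ (0 : ℝ) :=
        (virtualValue_le_coe_iff (hf.nonneg w) hws).2 (by simpa [k] using hwk)
      have hmono := hreg (mem_of_survival_pos hv0 hvs)
        (mem_of_survival_pos (hv0.trans hvw.le) hws) hvw.le
      have := (virtualValue_le_coe_iff (hf.nonneg v) hvs).1 (hmono.trans hw0)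
      simpa [k] using this
  have hupp : ∀ v ∈ Set.Ioc a z, 0 ≤ k v := by
    intro v hv
    have hnot : v ∉ Z := fun h => absurd (le_csSup hbdd h) (not_le.2 hv.1)
    by_contra hk
    push Not at hk
    refine hnot (Or.inr ⟨⟨hθa.trans hv.1.le, hv.2⟩, ?_, hk.le⟩)
    have := mul_nonneg (hθ.trans (hθa.trans hv.1.le)) (hf.nonneg v)
    simp only [k] at hk
    linarith
  have hint := (hf.intervalIntegrable_revenue_rate a z).1
  rw [hf.setLIntegral_virtualPart measurableSet_Ioc, ← Set.Ioc_union_Ioc_eq_Ioc hθa haz,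
    lintegral_union measurableSet_Ioc (Set.Ioc_disjoint_Ioc_of_le le_rfl)]
  have h0 : ∫⁻ v in Set.Ioc θ a, ENNReal.ofReal (v * f v - survival D v) = 0 := by
    rw [setLIntegral_congr Ioo_ae_eq_Ioc.symm]
    refine (setLIntegral_congr_fun measurableSet_Ioo fun v hv => ?_).trans (lintegral_zero)
    exact ENNReal.ofReal_of_nonpos (hlow v hv)
  have h1 : ∫⁻ v in Set.Ioc a z, ENNReal.ofReal (v * f v - survival D v) =
      ENNReal.ofReal (a * survival D a - z * survival D z) := by
    rw [← hf.integral_revenue_rate_zero haz, intervalIntegral.integral_of_le haz,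
      ofReal_integral_eq_lintegral_ofReal hint]
    filter_upwards [ae_restrict_mem measurableSet_Ioc] with v hv using hupp v hv
  rw [h0, h1, zero_add, ← ENNReal.ofReal_add]
  · exact ENNReal.ofReal_le_ofReal (by linarith)
  · rw [← hf.integral_revenue_rate_zero haz, intervalIntegral.integral_of_le haz]
    exact setIntegral_nonneg measurableSet_Ioc hupp
  · exact mul_nonneg (hθ.trans hθz) (survival_nonneg _)

/-- The boundary term need not vanish: for the tail `1 / v` the virtual value is zero although every
price in that tail earns 1. -/
theorem ofReal_revenue_le_add_revenueAtTop (hf : IsPdf f D) (τ : ℝ) :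
    ENNReal.ofReal (τ * survival D τ) ≤
      ∫⁻ v in Set.Ioi τ, ENNReal.ofReal (virtualPart f D v) ∂D + revenueAtTop D := by
  rw [← tsub_le_iff_left]
  refine Filter.le_liminf_of_le (by isBoundedDefault) ?_
  filter_upwards [Filter.eventually_ge_atTop (max τ 0)] with z hz
  rw [tsub_le_iff_left]
  exact hf.ofReal_revenue_le ((le_max_right _ _).trans hz) ((le_max_left _ _).trans hz)

/-- The left side is a limit of quantities bounded by revenues of prices `a ≥ θ`, and each such
price earns at most twice the revenue of the random price `max t s`. -/
theorem lintegral_virtualPart_add_le (hf : IsPdf f D) (h0 : D (Set.Iio 0) = 0)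
    (hreg : MonotoneOn (virtualValue f D) {v | 0 ≤ v ∧ cdf D v < 1}) {t θ : ℝ≥0} (h : t ≤ θ) :
    ∫⁻ v in Set.Ioi (θ : ℝ), ENNReal.ofReal (virtualPart f D v) ∂D + revenueAtTop D ≤
      2 * ∫⁻ v, ∫⁻ s, postedRevenue (((max t s.toNNReal : ℝ≥0) : ℝ≥0∞), v) ∂D ∂D := by
  have := hf.nullSingletonClass
  set R := 2 * ∫⁻ v, ∫⁻ s, postedRevenue (((max t s.toNNReal : ℝ≥0) : ℝ≥0∞), v) ∂D ∂D
  have hcompl : ∀ x : ℝ, D (Set.Iic x) = ENNReal.ofReal (1 - survival D x) := by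
    intro x
    rw [survival, ← Set.compl_Iic, probReal_compl_eq_one_sub measurableSet_Iic, sub_sub_cancel,
      ofReal_measureReal]
  have hrev : ∀ a : ℝ, (θ : ℝ) ≤ a → ENNReal.ofReal (a * survival D a) ≤ R := by
    intro a ha
    have ha0 : 0 ≤ a := θ.coe_nonneg.trans ha
    lift a to ℝ≥0 using ha0
    rw [ENNReal.ofReal_mul a.coe_nonneg, ofReal_survival, ENNReal.ofReal_coe_nnreal]
    refine mul_Ioi_le_postedRevenue h0 (h.trans (by exact_mod_cast ha)) fun s hs => ?_
    have h3 := hf.survival_mul_le_of_regular h0 hreg s.coe_nonneg (NNReal.coe_le_coe.2 hs)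
    rw [hcompl, hcompl, ← ofReal_survival, ← ofReal_survival, ← ENNReal.ofReal_coe_nnreal,
      ← ENNReal.ofReal_coe_nnreal, ← ENNReal.ofReal_mul a.coe_nonneg,
      ← ENNReal.ofReal_mul s.coe_nonneg,
      ← ENNReal.ofReal_mul (mul_nonneg a.coe_nonneg (survival_nonneg _)),
      ← ENNReal.ofReal_mul (mul_nonneg s.coe_nonneg (survival_nonneg _))]
    exact ENNReal.ofReal_le_ofReal h3
  -- The truncation `m` and the price `z` are separated so that `z` can tend to infinity first,
  -- producing `revenueAtTop`, and `m` afterwards.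
  have hM : ∀ m : ℝ, (θ : ℝ) ≤ m → ∀ z, m ≤ z →
      ∫⁻ v in Set.Ioc (θ : ℝ) m, ENNReal.ofReal (virtualPart f D v) ∂D +
        ENNReal.ofReal (z * survival D z) ≤ R := by
    intro m hm z hz
    obtain ⟨a, ha, hle⟩ := hf.exists_lintegral_virtualPart_le hreg θ.coe_nonneg (hm.trans hz)
    refine le_trans ?_ (hle.trans (hrev a ha))
    gcongr
  by_cases hR : R = ⊤
  · rw [hR]; exact le_top
  have hML : ∀ m : ℝ, (θ : ℝ) ≤ m →
      ∫⁻ v in Set.Ioc (θ : ℝ) m, ENNReal.ofReal (virtualPart f D v) ∂D ≤ R - revenueAtTop D ∧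
      revenueAtTop D ≤ R := by
    intro m hm
    have hI : ∫⁻ v in Set.Ioc (θ : ℝ) m, ENNReal.ofReal (virtualPart f D v) ∂D ≠ ⊤ :=
      ne_top_of_le_ne_top hR (le_self_add.trans (hM m hm m le_rfl))
    have hL : revenueAtTop D ≤
        R - ∫⁻ v in Set.Ioc (θ : ℝ) m, ENNReal.ofReal (virtualPart f D v) ∂D := by
      refine Filter.liminf_le_of_frequently_le' (Filter.Eventually.frequently ?_)
      filter_upwards [Filter.eventually_ge_atTop m] with z hz
      exact ENNReal.le_sub_of_add_le_left hI (hM m hm z hz)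
    have hLR := hL.trans tsub_le_self
    refine ⟨?_, hLR⟩
    refine ENNReal.le_sub_of_add_le_right (ne_top_of_le_ne_top hR hLR) ?_
    calc _ ≤ ∫⁻ v in Set.Ioc (θ : ℝ) m, ENNReal.ofReal (virtualPart f D v) ∂D +
          (R - ∫⁻ v in Set.Ioc (θ : ℝ) m, ENNReal.ofReal (virtualPart f D v) ∂D) := by gcongr
      _ = R := add_tsub_cancel_of_le (le_self_add.trans (hM m hm m le_rfl))
  have hIoi : ∫⁻ v in Set.Ioi (θ : ℝ), ENNReal.ofReal (virtualPart f D v) ∂D ≤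
      R - revenueAtTop D := by
    have hU : Set.Ioi (θ : ℝ) = ⋃ m : ℕ, Set.Ioc (θ : ℝ) (θ + m) := by
      ext v
      simp only [Set.mem_Ioi, Set.mem_iUnion, Set.mem_Ioc, exists_and_left]
      refine ⟨fun hv => ⟨hv, ?_⟩, fun hv => hv.1⟩
      obtain ⟨m, hm⟩ := exists_nat_ge (v - θ)
      exact ⟨m, by linarith⟩
    have hmono : Monotone fun m : ℕ => Set.Ioc (θ : ℝ) (θ + m) := fun i j hij =>
      Set.Ioc_subset_Ioc_right (by gcongr)
    rw [hU, setLIntegral_iUnion_of_directed _ hmono.directed_le]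
    exact iSup_le fun m => (hML _ (by simp)).1
  calc _ ≤ (R - revenueAtTop D) + revenueAtTop D := by gcongr
    _ = R := tsub_add_cancel_of_le (hML θ le_rfl).2

end IsPdf

/-! ### Truthful single-bidder mechanisms -/

/-- A truthful and individually rational mechanism for one bidder with values in `[0, ∞)`:
service probability `x` and expected payment `p` as functions of the bid. -/
structure TruthfulRule (x p : ℝ → ℝ) : Prop where
  nonneg : ∀ t, 0 ≤ t → 0 ≤ x t
  le_one : ∀ t, 0 ≤ t → x t ≤ 1
  truthful : ∀ t s, 0 ≤ t → 0 ≤ s → x s * t - p s ≤ x t * t - p t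
  rational : ∀ t, 0 ≤ t → 0 ≤ x t * t - p t

namespace TruthfulRule

variable {x p : ℝ → ℝ}

theorem monotoneOn (h : TruthfulRule x p) : MonotoneOn x (Set.Ici 0) := by
  intro s hs t ht hst
  rcases hst.eq_or_lt with rfl | hlt
  · exact le_rfl
  have h1 := h.truthful t s ht hs
  have h2 := h.truthful s t hs ht
  have h3 : 0 ≤ (x t - x s) * (t - s) := by linarith
  by_contra hc
  exact absurd h3 (not_le.2 (mul_neg_of_neg_of_pos (by linarith) (by linarith)))

theorem intervalIntegrable (h : TruthfulRule x p) {s t : ℝ} (hs : 0 ≤ s) (ht : 0 ≤ t) :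
    IntervalIntegrable x volume s t := by
  refine MonotoneOn.intervalIntegrable (h.monotoneOn.mono ?_)
  intro u hu
  exact (le_min hs ht).trans hu.1

/-- Half of Myerson's payment formula. Utility grows over `[s, t]` by at least `x s * (t - s)`, so
the gap `g` to the integral of `x` grows by at most `(x t - x s) * (t - s)`. Over `N` equal steps
these errors telescope to at most `v / N`. -/
theorem payment_le (h : TruthfulRule x p) {v : ℝ} (hv : 0 ≤ v) :
    p v ≤ v * x v - ∫ u in (0 : ℝ)..v, x u := by
  set g : ℝ → ℝ := fun t => (∫ u in (0 : ℝ)..t, x u) - (x t * t - p t)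
  have hstep : ∀ s t, 0 ≤ s → s ≤ t → g t - g s ≤ (x t - x s) * (t - s) := by
    intro s t hs hst
    have ht := hs.trans hst
    have h1 := h.truthful t s ht hs
    have h2 : (∫ u in (0 : ℝ)..t, x u) - ∫ u in (0 : ℝ)..s, x u = ∫ u in s..t, x u :=
      intervalIntegral.integral_interval_sub_left (h.intervalIntegrable le_rfl ht)
        (h.intervalIntegrable le_rfl hs)
    have h3 : ∫ u in s..t, x u ≤ ∫ _ in s..t, x t :=
      intervalIntegral.integral_mono_on hst (h.intervalIntegrable hs ht) (by simp)
        fun u hu => h.monotoneOn (hs.trans hu.1) ht hu.2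
    simp only [intervalIntegral.integral_const, smul_eq_mul] at h3
    simp only [g]
    linarith
  have hN : ∀ N : ℕ, 0 < N → g v ≤ v / N := by
    intro N hN
    have hN' : (0 : ℝ) < N := by exact_mod_cast hN
    have hk : ∀ k : ℕ, g (k * (v / N)) - g 0 ≤ (x (k * (v / N)) - x 0) * (v / N) := by
      intro k
      induction k with
      | zero => simp
      | succ k ih =>
        have hd : 0 ≤ v / N := by positivity
        have := hstep (k * (v / N)) ((k + 1 : ℕ) * (v / N)) (by positivity)
          (by push_cast; linarith)
        rw [show ((k + 1 : ℕ) : ℝ) * (v / N) - k * (v / N) = v / N by push_cast; ring] at this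
        linarith
    have h1 := hk N
    rw [mul_div_cancel₀ _ hN'.ne'] at h1
    have h2 : g 0 ≤ 0 := by
      have := h.rational 0 le_rfl
      simp only [g, intervalIntegral.integral_same]
      linarith
    have h3 : (x v - x 0) * (v / N) ≤ 1 * (v / N) := by
      refine mul_le_mul_of_nonneg_right ?_ (by positivity)
      linarith [h.le_one v hv, h.nonneg 0 le_rfl]
    linarith
  have hlim : Filter.Tendsto (fun N : ℕ => v / (N : ℝ)) Filter.atTop (nhds 0) :=
    tendsto_const_div_atTop_nhds_zero_nat v
  have hg : g v ≤ 0 := by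
    refine ge_of_tendsto hlim ?_
    filter_upwards [Filter.eventually_gt_atTop 0] with N hN' using hN N hN'
  simp only [g] at hg
  linarith

/-- The length of the interval of bids that are served with probability at most `c`. -/
noncomputable def cutoff (x : ℝ → ℝ) (c : ℝ) : ℝ≥0∞ := volume {u | 0 ≤ u ∧ x u ≤ c}

theorem measurable_cutoff (x : ℝ → ℝ) : Measurable (cutoff x) :=
  (show Monotone (cutoff x) from fun _ _ hab =>
    measure_mono fun _ hu => ⟨hu.1, hu.2.trans hab⟩).measurable

/-- A truthful rule is a random posted price: draw `c` uniformly from `[0, 1)`, post the price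
`cutoff x c`, and serve iff `c < x v`. Fubini on the area between `x u` and `x v` shows this. -/
theorem ofReal_payment_le (h : TruthfulRule x p) (hx : Measurable x) {v : ℝ} (hv : 0 ≤ v) :
    ENNReal.ofReal (p v) ≤
      ∫⁻ c in Set.Ico (0 : ℝ) 1, (Set.Iio (x v)).indicator (cutoff x) c := by
  have hint : ∫ u in Set.Ioc 0 v, (x v - x u) = v * x v - ∫ u in (0 : ℝ)..v, x u := by
    rw [← intervalIntegral.integral_of_le hv, intervalIntegral.integral_sub (by simp)
      (h.intervalIntegrable le_rfl hv)]
    simp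
  have hi : IntegrableOn (fun u => x v - x u) (Set.Ioc 0 v) :=
    ((intervalIntegrable_const (c := x v)).sub (h.intervalIntegrable le_rfl hv)).1
  calc ENNReal.ofReal (p v) ≤ ENNReal.ofReal (∫ u in Set.Ioc 0 v, (x v - x u)) :=
        ENNReal.ofReal_le_ofReal (hint ▸ h.payment_le hv)
    _ = ∫⁻ u in Set.Ioc 0 v, ENNReal.ofReal (x v - x u) := by
        refine ofReal_integral_eq_lintegral_ofReal hi ?_
        filter_upwards [ae_restrict_mem measurableSet_Ioc] with u hu
        exact sub_nonneg.2 (h.monotoneOn hu.1.le hv hu.2)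
    _ = ∫⁻ u in Set.Ioc 0 v, ∫⁻ c in Set.Ico (0 : ℝ) 1,
          {q : ℝ × ℝ | x q.1 ≤ q.2 ∧ q.2 < x v}.indicator 1 (u, c) := by
        refine setLIntegral_congr_fun measurableSet_Ioc fun u hu => ?_
        have : ∀ c, {q : ℝ × ℝ | x q.1 ≤ q.2 ∧ q.2 < x v}.indicator (1 : ℝ × ℝ → ℝ≥0∞) (u, c) =
            (Set.Ico (x u) (x v)).indicator 1 c := fun c => by simp [Set.indicator]
        simp only [this]
        rw [lintegral_indicator_one measurableSet_Ico, Measure.restrict_apply measurableSet_Ico,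
          Set.inter_eq_left.2, Real.volume_Ico]
        exact Set.Ico_subset_Ico (h.nonneg u hu.1.le) (h.le_one v hv)
    _ = ∫⁻ c in Set.Ico (0 : ℝ) 1, ∫⁻ u in Set.Ioc 0 v,
          {q : ℝ × ℝ | x q.1 ≤ q.2 ∧ q.2 < x v}.indicator 1 (u, c) := by
        refine lintegral_lintegral_swap (Measurable.aemeasurable ?_)
        exact measurable_one.indicator ((measurableSet_le (hx.comp measurable_fst)
          measurable_snd).inter (measurableSet_lt measurable_snd measurable_const))
    _ ≤ _ := by
        refine lintegral_mono fun c => ?_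
        by_cases hc : c < x v
        · rw [Set.indicator_of_mem (show c ∈ Set.Iio (x v) from hc), cutoff]
          have hm : MeasurableSet {u | x u ≤ c} := measurableSet_le hx measurable_const
          have : ∀ u, {q : ℝ × ℝ | x q.1 ≤ q.2 ∧ q.2 < x v}.indicator (1 : ℝ × ℝ → ℝ≥0∞) (u, c) =
            {u | x u ≤ c}.indicator 1 u := fun u => by simp [Set.indicator, hc]
          simp only [this]
          rw [lintegral_indicator_one hm, Measure.restrict_apply hm]
          exact measure_mono fun u hu => ⟨hu.2.1.le, hu.1⟩
        · simp [Set.indicator, hc]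

/-- The expected payment of a bidder with a given density is at most the expected positive part
of the virtual value when served, up to the limiting revenue of high prices. -/
theorem lintegral_payment_le (h : TruthfulRule x p) (hx : Measurable x) {f : ℝ → ℝ}
    {D : Measure ℝ} [IsProbabilityMeasure D] (hf : IsPdf f D) (h0 : D (Set.Iio 0) = 0) :
    ∫⁻ v, ENNReal.ofReal (p v) ∂D ≤
      ∫⁻ v, ENNReal.ofReal (x v * virtualPart f D v) ∂D + revenueAtTop D := by
  have := hf.nullSingletonClass
  have hnn : ∀ᵐ s ∂D, 0 ≤ s := by
    rw [ae_iff]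
    simpa [Set.Iio] using h0
  have hφ := hf.measurable_virtualPart.ennreal_ofReal
  have hSm : MeasurableSet {q : ℝ × ℝ | q.2 < x q.1} :=
    measurableSet_lt measurable_snd (hx.comp measurable_fst)
  have hSc : ∀ c, MeasurableSet {v | c < x v} := fun c => measurableSet_lt measurable_const hx
  -- For fixed `c` the served values form a ray starting at the cutoff, up to its endpoint, so the
  -- posted-price bound applies; an infinite cutoff means almost surely no service.
  have hcut : ∀ c, cutoff x c * D {v | c < x v} ≤
      ∫⁻ v in {v | c < x v}, ENNReal.ofReal (virtualPart f D v) ∂D + revenueAtTop D := by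
    intro c
    have hle : ∀ v, 0 ≤ v → c < x v → cutoff x c ≤ ENNReal.ofReal v := by
      intro v hv hc
      calc cutoff x c ≤ volume (Set.Icc 0 v) := by
            refine measure_mono fun u hu => ⟨hu.1, ?_⟩
            by_contra huv
            exact absurd (h.monotoneOn hv hu.1 (not_le.1 huv).le) (not_le.2 (hu.2.trans_lt hc))
        _ = ENNReal.ofReal v := by rw [Real.volume_Icc, sub_zero]
    by_cases htop : cutoff x c = ⊤
    · have : D {v | c < x v} = 0 := by
        refine measure_mono_null (fun v hv => ?_) (ae_iff.1 hnn)
        intro hv0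
        have := hle v hv0 hv
        rw [htop, top_le_iff] at this
        exact ENNReal.ofReal_ne_top this
      rw [this, mul_zero]
      exact zero_le
    · set τ := (cutoff x c).toReal
      have hτ : ENNReal.ofReal τ = cutoff x c := ENNReal.ofReal_toReal htop
      have hτ0 : 0 ≤ τ := ENNReal.toReal_nonneg
      have h1 : D {v | c < x v} ≤ ENNReal.ofReal (survival D τ) := by
        rw [ofReal_survival, measure_congr Ioi_ae_eq_Ici]
        refine measure_mono_ae ?_
        filter_upwards [hnn] with v hv hc
        have := hle v hv hc
        rw [← hτ, ENNReal.ofReal_le_ofReal_iff hv] at this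
        exact this
      have h2 : Set.Ioi τ ⊆ {v | c < x v} := by
        intro v hv
        by_contra hc
        have hv0 : 0 < v := lt_of_le_of_lt hτ0 hv
        have : ENNReal.ofReal v ≤ cutoff x c := by
          calc ENNReal.ofReal v = volume (Set.Icc 0 v) := by rw [Real.volume_Icc, sub_zero]
            _ ≤ volume {u | 0 ≤ u ∧ x u ≤ c} := measure_mono fun u hu =>
              ⟨hu.1, (h.monotoneOn hu.1 hv0.le hu.2).trans (not_lt.1 hc)⟩
        rw [← hτ, ENNReal.ofReal_le_ofReal_iff hτ0] at this
        exact absurd hv (not_lt.2 this)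
      calc cutoff x c * D {v | c < x v}
          ≤ ENNReal.ofReal τ * ENNReal.ofReal (survival D τ) := by rw [hτ]; gcongr
        _ = ENNReal.ofReal (τ * survival D τ) := (ENNReal.ofReal_mul hτ0).symm
        _ ≤ _ := hf.ofReal_revenue_le_add_revenueAtTop τ
        _ ≤ _ := by gcongr
  calc ∫⁻ v, ENNReal.ofReal (p v) ∂D
      ≤ ∫⁻ v, (∫⁻ c in Set.Ico (0 : ℝ) 1,
          {q : ℝ × ℝ | q.2 < x q.1}.indicator (fun q => cutoff x q.2) (v, c)) ∂D := by
        refine lintegral_mono_ae ?_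
        filter_upwards [hnn] with v hv
        refine (h.ofReal_payment_le hx hv).trans (le_of_eq (lintegral_congr fun c => ?_))
        simp [Set.indicator]
    _ = ∫⁻ c in Set.Ico (0 : ℝ) 1, ∫⁻ v,
          {q : ℝ × ℝ | q.2 < x q.1}.indicator (fun q => cutoff x q.2) (v, c) ∂D := by
        refine lintegral_lintegral_swap (Measurable.aemeasurable ?_)
        exact ((measurable_cutoff x).comp measurable_snd).indicator hSm
    _ = ∫⁻ c in Set.Ico (0 : ℝ) 1, cutoff x c * D {v | c < x v} := by
        refine lintegral_congr fun c => ?_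
        rw [← setLIntegral_const, ← lintegral_indicator (hSc c)]
        exact lintegral_congr fun v => by simp [Set.indicator]
    _ ≤ ∫⁻ c in Set.Ico (0 : ℝ) 1,
          (∫⁻ v in {v | c < x v}, ENNReal.ofReal (virtualPart f D v) ∂D + revenueAtTop D) :=
        lintegral_mono fun c => hcut c
    _ = (∫⁻ c in Set.Ico (0 : ℝ) 1, ∫⁻ v in {v | c < x v},
          ENNReal.ofReal (virtualPart f D v) ∂D) + revenueAtTop D := by
        rw [lintegral_add_right _ measurable_const]
        simp
    _ = (∫⁻ c in Set.Ico (0 : ℝ) 1, ∫⁻ v, {q : ℝ × ℝ | q.2 < x q.1}.indicator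
          (fun q => ENNReal.ofReal (virtualPart f D q.1)) (v, c) ∂D) + revenueAtTop D := by
        congr 1
        refine lintegral_congr fun c => ?_
        rw [← lintegral_indicator (hSc c)]
        exact lintegral_congr fun v => by simp [Set.indicator]
    _ = (∫⁻ v, (∫⁻ c in Set.Ico (0 : ℝ) 1, {q : ℝ × ℝ | q.2 < x q.1}.indicator
          (fun q => ENNReal.ofReal (virtualPart f D q.1)) (v, c)) ∂D) + revenueAtTop D := by
        congr 1
        refine (lintegral_lintegral_swap (Measurable.aemeasurable ?_)).symm
        exact (hφ.comp measurable_fst).indicator hSm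
    _ = _ := by
        congr 1
        refine lintegral_congr_ae ?_
        filter_upwards [hnn] with v hv
        have : ∀ c, {q : ℝ × ℝ | q.2 < x q.1}.indicator
          (fun q => ENNReal.ofReal (virtualPart f D q.1)) (v, c) =
          (Set.Iio (x v)).indicator (fun _ => ENNReal.ofReal (virtualPart f D v)) c :=
          fun c => by simp [Set.indicator]
        simp only [this]
        have hI : Set.Iio (x v) ∩ Set.Ico 0 1 = Set.Ico 0 (x v) := by
          ext c
          exact ⟨fun hc => ⟨hc.2.1, hc.1⟩, fun hc => ⟨hc.2, hc.1, hc.2.trans_le (h.le_one v hv)⟩⟩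
        rw [lintegral_indicator measurableSet_Iio, setLIntegral_const,
          Measure.restrict_apply measurableSet_Iio, hI, Real.volume_Ico,
          ENNReal.ofReal_mul (h.nonneg v hv), mul_comm, sub_zero]

end TruthfulRule

/-! ### Competitive ratios -/

/-- For the benchmark the negative part of the payments may be dropped. -/
theorem extMean_le {Ω : Type*} [MeasurableSpace Ω] (μ : Measure Ω) (g : Ω → ℝ) :
    extMean μ g ≤ ((∫⁻ ω, ENNReal.ofReal (g ω) ∂μ : ℝ≥0∞) : EReal) := by
  rw [extMean]
  refine (EReal.sub_le_sub le_rfl (EReal.coe_ennreal_nonneg _)).trans ?_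
  simp

theorem extMean_of_nonneg {Ω : Type*} [MeasurableSpace Ω] (μ : Measure Ω) {g : Ω → ℝ}
    (hg : ∀ ω, 0 ≤ g ω) :
    extMean μ g = ((∫⁻ ω, ENNReal.ofReal (g ω) ∂μ : ℝ≥0∞) : EReal) := by
  have : ∀ ω, ENNReal.ofReal (-g ω) = 0 := fun ω =>
    ENNReal.ofReal_of_nonpos (neg_nonpos.2 (hg ω))
  simp [extMean, this]

theorem EReal.coe_mul_le_of_le {a : ℝ} (ha : 0 ≤ a) {E : EReal} {X R : ℝ≥0∞} (hE : E ≤ X)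
    (hX : ENNReal.ofReal a * X ≤ R) : (a : EReal) * E ≤ R := by
  have h1 : (a : EReal) = ((ENNReal.ofReal a : ℝ≥0∞) : EReal) := by
    rw [EReal.coe_ennreal_ofReal, max_eq_left ha]
  rw [h1]
  calc ((ENNReal.ofReal a : ℝ≥0∞) : EReal) * E
      ≤ ((ENNReal.ofReal a : ℝ≥0∞) : EReal) * X :=
        mul_le_mul_of_nonneg_left hE (EReal.coe_ennreal_nonneg _)
    _ = ((ENNReal.ofReal a * X : ℝ≥0∞) : EReal) := (EReal.coe_ennreal_mul _ _).symm
    _ ≤ R := EReal.coe_ennreal_le_coe_ennreal_iff.2 hX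

theorem ENNReal.ofReal_inv_mul_le {k : ℝ≥0} (hk : 0 < k) {a : ℝ} (ha : a ≤ 1 / k) {X R : ℝ≥0∞}
    (h : X ≤ k * R) : ENNReal.ofReal a * X ≤ R := by
  have hk0 : (k : ℝ≥0∞) ≠ 0 := by exact_mod_cast hk.ne'
  calc ENNReal.ofReal a * X ≤ (k : ℝ≥0∞)⁻¹ * (k * R) := by
        gcongr
        calc ENNReal.ofReal a ≤ ENNReal.ofReal (1 / k) := ENNReal.ofReal_le_ofReal ha
          _ = (k : ℝ≥0∞)⁻¹ := by
            rw [one_div, ENNReal.ofReal_inv_of_pos (by exact_mod_cast hk),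
              ENNReal.ofReal_coe_nnreal]
    _ = R := by rw [← mul_assoc, ENNReal.inv_mul_cancel hk0 (by simp), one_mul]

namespace SingleSampleSPM

variable {n : ℕ} (P : SingleSampleSPM n) (D : Fin n → Measure ℝ)

theorem measurable_price_bid (i : Fin n) {g : ℝ≥0∞ × ℝ → ℝ≥0∞} (hg : Measurable g) :
    Measurable fun q : P.Coin × (Fin n → ℝ) × (Fin n → ℝ) =>
      g (P.price q.1 q.2.1 q.2.2 i, q.2.2 i) :=
  hg.comp ((P.measurable_price i).prodMk
    ((measurable_pi_apply i).comp (measurable_snd.comp measurable_snd)))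

theorem revenue_eq :
    P.revenue D = ((∑ i, ∫⁻ q, postedRevenue (P.price q.1 q.2.1 q.2.2 i, q.2.2 i) ∂P.law D :
      ℝ≥0∞) : EReal) := by
  rw [revenue, extMean_of_nonneg _ fun q =>
    Finset.sum_nonneg fun i _ => P.toMechanism_p_nonneg q.1 q.2.1 q.2.2 i,
    ← lintegral_finsetSum _ fun i _ => P.measurable_price_bid i measurable_postedRevenue]
  congr 1
  refine lintegral_congr fun q => ?_
  rw [ENNReal.ofReal_sum_of_nonneg fun i _ => P.toMechanism_p_nonneg q.1 q.2.1 q.2.2 i]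
  refine Finset.sum_congr rfl fun i _ => ?_
  simp only [toMechanism, winners, Set.indicator, Set.mem_ofPred_eq, postedRevenue]
  split_ifs with h
  · exact ENNReal.ofReal_toReal h.ne_top
  · simp

theorem welfare_eq :
    P.welfare D = ((∑ i, ∫⁻ q, postedWelfare (P.price q.1 q.2.1 q.2.2 i, q.2.2 i) ∂P.law D :
      ℝ≥0∞) : EReal) := by
  have hnn : ∀ (q : P.Coin × (Fin n → ℝ) × (Fin n → ℝ)) i,
      0 ≤ (P.toMechanism q.1 q.2.1).x q.2.2 i * q.2.2 i := by
    intro q i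
    simp only [toMechanism, winners, Set.indicator, Set.mem_ofPred_eq]
    split_ifs with h
    · simpa using (ENNReal.ofReal_pos.1 (bot_le.trans_lt h)).le
    · simp
  rw [welfare, extMean_of_nonneg _ fun q => Finset.sum_nonneg fun i _ => hnn q i,
    ← lintegral_finsetSum _ fun i _ => P.measurable_price_bid i measurable_postedWelfare]
  congr 1
  refine lintegral_congr fun q => ?_
  rw [ENNReal.ofReal_sum_of_nonneg fun i _ => hnn q i]
  refine Finset.sum_congr rfl fun i _ => ?_
  simp only [toMechanism, winners, Set.indicator, Set.mem_ofPred_eq, postedWelfare]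
  split_ifs with h
  · simp
  · simp

end SingleSampleSPM

namespace Mechanism

variable {n : ℕ} {A : Mechanism n} {M : Matroid (Fin n)}

theorem truthfulRule (hfeas : A.Feasible M) (htruth : A.Truthful) (hir : A.IndividuallyRational)
    {v : Fin n → ℝ} (hv : ∀ j, 0 ≤ v j) (i : Fin n) :
    TruthfulRule (fun t => A.x (Function.update v i t) i)
      (fun t => A.p (Function.update v i t) i) := by
  have hup : ∀ t, 0 ≤ t → ∀ j, 0 ≤ Function.update v i t j := by
    intro t ht j
    rcases eq_or_ne j i with rfl | hj
    · simpa
    · simpa [hj] using hv j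
  refine ⟨fun t ht => ?_, fun t ht => ?_, fun t s ht hs => ?_, fun t ht => ?_⟩
  · exact (Matroid.mem_Icc_of_mem_convexHull (hfeas _ (hup t ht)) i).1
  · exact (Matroid.mem_Icc_of_mem_convexHull (hfeas _ (hup t ht)) i).2.1
  · have := htruth i t (Function.update v i s) ht (hup s hs)
    simpa [utility] using this
  · have := hir i t v ht hv
    simpa [utility] using this

theorem payment_le (hir : A.IndividuallyRational) {v : Fin n → ℝ} (hv : ∀ j, 0 ≤ v j)
    (i : Fin n) : A.p v i ≤ A.x v i * v i := by
  have := hir i (v i) v (hv i) hv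
  rw [Function.update_eq_self, utility] at this
  linarith

end Mechanism

/-! ### Bounding the benchmarks and assembling the ratios -/

namespace Matroid

variable {n : ℕ} {M : Matroid (Fin n)} {D : Fin n → Measure ℝ} [∀ i, IsProbabilityMeasure (D i)]

/-- The complement is upward closed, hence a union of rational rays, each of measure zero, and
possibly one least point. It is needed since regularity is assumed only where the cdf is below 1. -/
theorem ae_cdf_lt_one {D : Measure ℝ} [IsProbabilityMeasure D] [NullSingletonClass D] :
    ∀ᵐ y ∂D, cdf D y < 1 := by
  set Z : Set ℝ := {y | ¬ cdf D y < 1}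
  have hZ : ∀ y z, y ∈ Z → y ≤ z → z ∈ Z := fun y z hy hyz h =>
    hy ((monotone_cdf D hyz).trans_lt h)
  have hnull : ∀ y ∈ Z, D (Set.Ioi y) = 0 := by
    intro y hy
    rw [← ofReal_survival, ← one_sub_cdf, ENNReal.ofReal_eq_zero]
    linarith [not_lt.1 hy]
  have hsub : Z ⊆ (⋃ q : ℚ, ⋃ _ : (q : ℝ) ∈ Z, Set.Ioi (q : ℝ)) ∪ {z | IsLeast Z z} := by
    intro z hz
    by_cases h : IsLeast Z z
    · exact Or.inr h
    · obtain ⟨y, hy, hyz⟩ : ∃ y ∈ Z, y < z := by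
        by_contra hc
        push Not at hc
        exact h ⟨hz, hc⟩
      obtain ⟨q, hyq, hqz⟩ := exists_rat_btwn hyz
      exact Or.inl (Set.mem_iUnion₂.2 ⟨q, hZ y q hy hyq.le, hqz⟩)
  refine measure_mono_null hsub (measure_union_null ?_ ?_)
  · exact measure_iUnion_null fun q => measure_iUnion_null fun hq => hnull _ hq
  · exact Set.Subsingleton.measure_zero (fun _ ha _ hb => ha.unique hb) _

/-- Almost surely all values are positive and distinct. -/
theorem ae_pos_and_injective [∀ i, NullSingletonClass (D i)] (h0 : ∀ i, D i (Set.Iio 0) = 0) :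
    ∀ᵐ v ∂Measure.pi D, (∀ i, 0 < v i) ∧ Function.Injective v := by
  have hpos : ∀ i, ∀ᵐ v ∂Measure.pi D, 0 < v i := by
    intro i
    refine ae_pi_coord D (p := fun y => 0 < y) ?_
    rw [ae_iff]
    have : {y : ℝ | ¬ 0 < y} = Set.Iic 0 := by ext; simp
    rw [this, measure_congr Iio_ae_eq_Iic.symm, h0]
  filter_upwards [ae_all_iff.2 hpos, ae_pi_injective D] with v h1 h2 using ⟨h1, h2⟩

theorem measurable_setLIntegral_Ioi_coe (g : ℝ → ℝ≥0∞) (μ : Measure ℝ) :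
    Measurable fun θ : ℝ≥0 => ∫⁻ y in Set.Ioi (θ : ℝ), g y ∂μ :=
  (show Antitone fun θ : ℝ≥0 => ∫⁻ y in Set.Ioi (θ : ℝ), g y ∂μ from fun _ _ h =>
    lintegral_mono_set (Set.Ioi_subset_Ioi (by exact_mod_cast h))).measurable

-- The threshold of `i` ignores `v i`, so `v i` can be integrated first, over the ray above the
-- threshold.
open Classical in
theorem lintegral_sum_greedySet {g : ℝ → ℝ≥0∞} (hg : Measurable g) :
    ∫⁻ v, ∑ i, (M.greedySet v).indicator (fun i => g (v i)) i ∂Measure.pi D =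
      ∑ i with i ∉ M.closure ∅, ∫⁻ v,
        ∫⁻ y in Set.Ioi (M.threshold i (Finset.univ.erase i) v : ℝ), g y ∂D i ∂Measure.pi D := by
  have hS : ∀ i, MeasurableSet {v : Fin n → ℝ |
      (M.threshold i (Finset.univ.erase i) v : ℝ) < v i} := fun i =>
    measurableSet_lt (measurable_threshold i _).coe_nnreal_real (measurable_pi_apply i)
  have hgi : ∀ i, Measurable fun v : Fin n → ℝ => g (v i) := fun i => hg.comp (measurable_pi_apply i)
  have hsum : ∀ v : Fin n → ℝ, ∑ i, (M.greedySet v).indicator (fun i => g (v i)) i =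
      ∑ i with i ∉ M.closure ∅, {v : Fin n → ℝ |
        (M.threshold i (Finset.univ.erase i) v : ℝ) < v i}.indicator (fun v => g (v i)) v := by
    intro v
    rw [Finset.sum_filter]
    refine Finset.sum_congr rfl fun i _ => ?_
    by_cases hi : i ∈ M.closure ∅ <;> simp [greedySet, Set.indicator, hi]
  simp only [hsum]
  rw [lintegral_finsetSum _ fun i _ => (hgi i).indicator (hS i)]
  refine Finset.sum_congr rfl fun i _ => ?_
  rw [lintegral_pi_eq_lintegral_update D i ((hgi i).indicator (hS i))]
  refine lintegral_congr fun v => ?_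
  rw [← lintegral_indicator measurableSet_Ioi]
  refine lintegral_congr fun y => ?_
  simp [Set.indicator, threshold_update]

theorem ofReal_sum_le_greedySet (hM : M.E = Set.univ) {v : Fin n → ℝ} (hpos : ∀ i, 0 < v i)
    (hinj : Function.Injective v) {g : ℝ → ℝ} (hg0 : ∀ i, 0 ≤ g (v i))
    (hg : ∀ i j, v i ≤ v j → g (v i) ≤ g (v j)) {y : Fin n → ℝ}
    (hy : y ∈ convexHull ℝ {y : Fin n → ℝ | ∃ S, M.Indep S ∧ y = S.indicator 1}) :
    ENNReal.ofReal (∑ i, y i * g (v i)) ≤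
      ∑ i, (M.greedySet v).indicator (fun i => ENNReal.ofReal (g (v i))) i := by
  refine (ENNReal.ofReal_le_ofReal
    (sum_le_sum_greedySet hM hinj hpos (W := fun i => g (v i)) hg0 hg hy)).trans ?_
  rw [ENNReal.ofReal_sum_of_nonneg fun i _ => Set.indicator_nonneg (fun i _ => hg0 i) i]
  refine le_of_eq (Finset.sum_congr rfl fun i _ => ?_)
  by_cases hi : i ∈ M.greedySet v <;> simp [hi]

theorem optWelfare_le_greedySet (hM : M.E = Set.univ) {v : Fin n → ℝ} (hpos : ∀ i, 0 < v i)
    (hinj : Function.Injective v) :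
    ENNReal.ofReal (optWelfare M v) ≤
      ∑ i, (M.greedySet v).indicator (fun i => ENNReal.ofReal (v i)) i := by
  classical
  have hne : Nonempty {S : Finset (Fin n) // M.Indep (S : Set (Fin n))} := ⟨⟨∅, by simp⟩⟩
  obtain ⟨S, hS⟩ := exists_eq_ciSup_of_finite
    (f := fun S : {S : Finset (Fin n) // M.Indep (S : Set (Fin n))} => ∑ i ∈ S.1, v i)
  rw [optWelfare, ← hS]
  refine le_trans (le_of_eq ?_) (ofReal_sum_le_greedySet hM hpos hinj (g := fun y => y)
    (fun i => (hpos i).le) (fun _ _ h => h)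
    (subset_convexHull ℝ _ ⟨(S.1 : Set (Fin n)), S.2, rfl⟩))
  congr 1
  simp [Set.indicator]

/-- By individual rationality payments are at most values, so the MHR revenue bound even holds
against the welfare benchmark. -/
theorem lintegral_payment_le_greedySet (hM : M.E = Set.univ)
    [∀ i, NullSingletonClass (D i)] (h0 : ∀ i, D i (Set.Iio 0) = 0)
    {A : Mechanism n} (hfeas : A.Feasible M) (hir : A.IndividuallyRational) :
    ∫⁻ v, ENNReal.ofReal (∑ i, A.p v i) ∂Measure.pi D ≤
      ∫⁻ v, ∑ i, (M.greedySet v).indicator (fun i => ENNReal.ofReal (v i)) i ∂Measure.pi D := by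
  refine lintegral_mono_ae ?_
  filter_upwards [ae_pos_and_injective h0] with v hv
  refine (ENNReal.ofReal_le_ofReal (Finset.sum_le_sum fun i _ =>
    A.payment_le hir (fun j => (hv.1 j).le) i)).trans ?_
  exact ofReal_sum_le_greedySet hM hv.1 hv.2 (g := fun y => y) (fun i => (hv.1 i).le)
    (fun _ _ h => h) (hfeas v fun j => (hv.1 j).le)

open Classical in
/-- Summing a lower bound for the contribution of each bidder that is not a loop. -/
theorem sum_lintegral_threshold_le (hM : M.E = Set.univ) {g : ℝ≥0∞ × ℝ → ℝ≥0∞}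
    (hg : Measurable g) {K : Fin n → ℝ≥0 → ℝ≥0∞} (hKm : ∀ i, Measurable (K i)) {r : ℝ≥0}
    (hr : 0 < r) (hK : ∀ i, ∀ t θ : ℝ≥0, t ≤ θ → K i θ ≤
      r * ∫⁻ v, ∫⁻ s, g (((max t s.toNNReal : ℝ≥0) : ℝ≥0∞), v) ∂D i ∂D i) :
    ∑ i with i ∉ M.closure ∅,
      ∫⁻ v, K i (M.threshold i (Finset.univ.erase i) v) ∂Measure.pi D ≤
      (4 * r : ℝ≥0) *
        ∑ i, ∫⁻ q, g (M.sampleSPM.price q.1 q.2.1 q.2.2 i, q.2.2 i) ∂M.sampleSPM.law D := by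
  have hr0 : (r : ℝ≥0∞) ≠ 0 := by exact_mod_cast hr.ne'
  rw [Finset.mul_sum]
  refine (Finset.sum_le_sum fun i hi => ?_).trans
    (Finset.sum_le_sum_of_subset (Finset.filter_subset _ _))
  have h := lintegral_threshold_le_sampleSPM hM D (Finset.mem_filter.1 hi).2 hg
    -- The single-bidder reduction expects constant 1, so `K` is scaled down by `r` and back
    -- afterwards.
    (K := fun θ => (r : ℝ≥0∞)⁻¹ * K i θ) ((hKm i).const_mul _) (fun t θ hle => by
      refine (mul_le_mul_right (hK i t θ hle) _).trans (le_of_eq ?_)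
      rw [← mul_assoc, ENNReal.inv_mul_cancel hr0 (by simp), one_mul])
  have hKi : Measurable fun v => K i (M.threshold i (Finset.univ.erase i) v) :=
    (hKm i).comp (measurable_threshold i _)
  rw [lintegral_const_mul _ hKi] at h
  have h2 := mul_le_mul_right h (r : ℝ≥0∞)
  rw [← mul_assoc, ENNReal.mul_inv_cancel hr0 (by simp), one_mul] at h2
  refine h2.trans (le_of_eq ?_)
  push_cast
  ring

theorem sampleSPM_welfareCompetitive (hM : M.E = Set.univ) [∀ i, NullSingletonClass (D i)]
    (h0 : ∀ i, D i (Set.Iio 0) = 0) : M.sampleSPM.WelfareCompetitive M D (1 / 8) := by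
  rw [SingleSampleSPM.WelfareCompetitive, SingleSampleSPM.welfare_eq]
  refine EReal.coe_mul_le_of_le (by norm_num) (extMean_le _ _)
    (ENNReal.ofReal_inv_mul_le (k := 4 * 2) (by norm_num) (by norm_num) ?_)
  calc ∫⁻ v, ENNReal.ofReal (optWelfare M v) ∂Measure.pi D
      ≤ ∫⁻ v, ∑ i, (M.greedySet v).indicator (fun i => ENNReal.ofReal (v i)) i ∂Measure.pi D := by
        refine lintegral_mono_ae ?_
        filter_upwards [ae_pos_and_injective h0] with v hv
        exact optWelfare_le_greedySet hM hv.1 hv.2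
    _ ≤ _ := by
        rw [lintegral_sum_greedySet ENNReal.measurable_ofReal]
        exact sum_lintegral_threshold_le hM measurable_postedWelfare
          (K := fun i θ => ∫⁻ y in Set.Ioi (θ : ℝ), ENNReal.ofReal y ∂D i)
          (fun i => measurable_setLIntegral_Ioi_coe _ _) (by norm_num)
          fun i t θ h => lintegral_Ioi_le_postedWelfare h

theorem sampleSPM_revenueCompetitive_of_mhr (hM : M.E = Set.univ)
    (hD : ∀ i, IsMHRDist (D i)) :
    M.sampleSPM.RevenueCompetitive M D (1 / (8 * Real.exp 1)) := by
  have h0 : ∀ i, D i (Set.Iio 0) = 0 := fun i => (hD i).1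
  choose f hf hmono using fun i => (hD i).2
  have hns : ∀ i, NullSingletonClass (D i) := fun i => (hf i).nullSingletonClass
  intro A _ _ hfeas _ hir
  rw [SingleSampleSPM.revenue_eq]
  -- The argument yields 1/16, which suffices because `8 * exp 1 ≥ 16`.
  have he : (2 : ℝ) ≤ Real.exp 1 := by linarith [Real.add_one_le_exp (1 : ℝ)]
  refine EReal.coe_mul_le_of_le (by positivity) (extMean_le _ _)
    (ENNReal.ofReal_inv_mul_le (k := 4 * 4) (by norm_num) ?_ ?_)
  · refine one_div_le_one_div_of_le (by norm_num) ?_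
    push_cast
    linarith
  refine (lintegral_payment_le_greedySet hM h0 hfeas hir).trans ?_
  rw [lintegral_sum_greedySet ENNReal.measurable_ofReal]
  exact sum_lintegral_threshold_le hM measurable_postedRevenue
    (K := fun i θ => ∫⁻ y in Set.Ioi (θ : ℝ), ENNReal.ofReal y ∂D i)
    (fun i => measurable_setLIntegral_Ioi_coe _ _) (by norm_num)
    fun i t θ h => lintegral_Ioi_le_postedRevenue
      (fun x hx => (hf i).measure_Ioi_two_mul_le (h0 i) (hmono i) hx) h

open Classical in
/-- The expected payments of a truthful mechanism are at most the expected virtual values of the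
greedy set, up to the limiting revenue of high prices. -/
theorem lintegral_payment_le_virtualPart (hM : M.E = Set.univ) {D₀ : Measure ℝ}
    [IsProbabilityMeasure D₀] (h0 : D₀ (Set.Iio 0) = 0) {f : ℝ → ℝ} (hf : IsPdf f D₀)
    (hreg : MonotoneOn (virtualValue f D₀) {v | 0 ≤ v ∧ cdf D₀ v < 1})
    {A : Mechanism n} (hx : Measurable A.x) (hp : Measurable A.p) (hfeas : A.Feasible M)
    (htruth : A.Truthful) (hir : A.IndividuallyRational) :
    ∫⁻ v, ENNReal.ofReal (∑ i, A.p v i) ∂Measure.pi (fun _ => D₀) ≤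
      ∑ i with i ∉ M.closure ∅, ∫⁻ v,
        (∫⁻ y in Set.Ioi (M.threshold i (Finset.univ.erase i) v : ℝ),
          ENNReal.ofReal (virtualPart f D₀ y) ∂D₀ + revenueAtTop D₀)
            ∂Measure.pi (fun _ => D₀) := by
  have hns := hf.nullSingletonClass
  set μ := Measure.pi (fun _ : Fin n => D₀)
  have hae : ∀ᵐ v ∂μ, (∀ i, 0 < v i) ∧ Function.Injective v :=
    ae_pos_and_injective (D := fun _ : Fin n => D₀) fun _ => h0
  have hφ := hf.measurable_virtualPart
  have hxi : ∀ i, Measurable fun v => A.x v i := fun i => (measurable_pi_apply i).comp hx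
  have hpi : ∀ i, Measurable fun v => A.p v i := fun i => (measurable_pi_apply i).comp hp
  have hxφ : ∀ i, Measurable fun v : Fin n → ℝ => A.x v i * virtualPart f D₀ (v i) := fun i =>
    (hxi i).mul (hφ.comp (measurable_pi_apply i))
  have hbidder : ∀ i, ∫⁻ v, ENNReal.ofReal (A.p v i) ∂μ ≤
      ∫⁻ v, ENNReal.ofReal (A.x v i * virtualPart f D₀ (v i)) ∂μ + revenueAtTop D₀ := by
    intro i
    rw [lintegral_pi_eq_lintegral_update (fun _ => D₀) i (hpi i).ennreal_ofReal,
      lintegral_pi_eq_lintegral_update (fun _ => D₀) i (hxφ i).ennreal_ofReal]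
    calc _ ≤ ∫⁻ v, (∫⁻ y, ENNReal.ofReal (A.x (Function.update v i y) i *
            virtualPart f D₀ (Function.update v i y i)) ∂D₀ + revenueAtTop D₀) ∂μ := by
          refine lintegral_mono_ae ?_
          filter_upwards [hae] with v hv
          have h := (A.truthfulRule hfeas htruth hir (fun j => (hv.1 j).le) i).lintegral_payment_le
            ((hxi i).comp (measurable_update v)) hf h0
          simpa using h
      _ = _ := by
          rw [lintegral_add_right _ measurable_const]
          simp [μ]
  -- Loops pay nothing and must be removed here: otherwise each would add a term `revenueAtTop` that
  -- the mechanism cannot match.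
  have hloop : ∀ i, i ∈ M.closure ∅ → ∫⁻ v, ENNReal.ofReal (A.p v i) ∂μ = 0 := by
    intro i hi
    refine lintegral_eq_zero_of_ae_eq_zero ?_
    filter_upwards [hae] with v hv
    refine ENNReal.ofReal_of_nonpos ((A.payment_le hir (fun j => (hv.1 j).le) i).trans ?_)
    rw [(mem_Icc_of_mem_convexHull (hfeas v fun j => (hv.1 j).le) i).2.2 hi, zero_mul]
  have hcdf := ae_cdf_lt_one (D := D₀)
  -- Identical distributions matter here: with a common virtual value function, the order of values
  -- is also an order of virtual values across bidders, so the set greedy for values is optimal for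
  -- both.
  have hgreedy : ∫⁻ v, ∑ i, ENNReal.ofReal (A.x v i * virtualPart f D₀ (v i)) ∂μ ≤
      ∫⁻ v, ∑ i, (M.greedySet v).indicator
        (fun i => ENNReal.ofReal (virtualPart f D₀ (v i))) i ∂μ := by
    refine lintegral_mono_ae ?_
    filter_upwards [hae, ae_all_iff.2 fun i => ae_pi_coord (fun _ : Fin n => D₀) (i := i) hcdf]
      with v hv hc
    have hnn : ∀ j, 0 ≤ v j := fun j => (hv.1 j).le
    rw [← ENNReal.ofReal_sum_of_nonneg fun i _ => mul_nonneg
      (mem_Icc_of_mem_convexHull (hfeas v hnn) i).1 (virtualPart_nonneg _ _ _)]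
    exact ofReal_sum_le_greedySet hM hv.1 hv.2 (fun i => virtualPart_nonneg _ _ _)
      (fun i j hij => IsPdf.monotoneOn_virtualPart hreg ⟨hnn i, hc i⟩ ⟨hnn j, hc j⟩ hij)
      (hfeas v hnn)
  calc ∫⁻ v, ENNReal.ofReal (∑ i, A.p v i) ∂μ
      ≤ ∫⁻ v, ∑ i, ENNReal.ofReal (A.p v i) ∂μ :=
        lintegral_mono fun v => Finset.le_sum_of_subadditive ENNReal.ofReal
          ENNReal.ofReal_zero.le (fun _ _ => ENNReal.ofReal_add_le) _ _
    _ = ∑ i, ∫⁻ v, ENNReal.ofReal (A.p v i) ∂μ :=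
        lintegral_finsetSum _ fun i _ => (hpi i).ennreal_ofReal
    _ = ∑ i with i ∉ M.closure ∅, ∫⁻ v, ENNReal.ofReal (A.p v i) ∂μ := by
        rw [Finset.sum_filter]
        refine Finset.sum_congr rfl fun i _ => ?_
        split_ifs with hi
        · exact hloop i hi
        · rfl
    _ ≤ ∑ i with i ∉ M.closure ∅, (∫⁻ v, ENNReal.ofReal (A.x v i * virtualPart f D₀ (v i)) ∂μ +
          revenueAtTop D₀) := Finset.sum_le_sum fun i _ => hbidder i
    _ ≤ ∑ i, ∫⁻ v, ENNReal.ofReal (A.x v i * virtualPart f D₀ (v i)) ∂μ +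
          ∑ i with i ∉ M.closure ∅, revenueAtTop D₀ := by
        rw [Finset.sum_add_distrib]
        exact add_le_add (Finset.sum_le_sum_of_subset (Finset.filter_subset _ _)) le_rfl
    _ ≤ ∫⁻ v, ∑ i, (M.greedySet v).indicator
          (fun i => ENNReal.ofReal (virtualPart f D₀ (v i))) i ∂μ +
          ∑ i with i ∉ M.closure ∅, revenueAtTop D₀ := by
        rw [← lintegral_finsetSum _ fun i _ => (hxφ i).ennreal_ofReal]
        exact add_le_add hgreedy le_rfl
    _ = _ := by
        rw [lintegral_sum_greedySet hφ.ennreal_ofReal, ← Finset.sum_add_distrib]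
        refine Finset.sum_congr rfl fun i _ => ?_
        rw [lintegral_add_right _ measurable_const]
        simp [μ]

theorem sampleSPM_revenueCompetitive_of_regular (hM : M.E = Set.univ) {D₀ : Measure ℝ}
    [IsProbabilityMeasure D₀] (hD : IsRegularDist D₀) :
    M.sampleSPM.RevenueCompetitive M (fun _ => D₀) (1 / 8) := by
  obtain ⟨h0, f, hf, hreg⟩ := hD
  intro A hx hp hfeas htruth hir
  rw [SingleSampleSPM.revenue_eq]
  refine EReal.coe_mul_le_of_le (by norm_num) (extMean_le _ _)
    (ENNReal.ofReal_inv_mul_le (k := 4 * 2) (by norm_num) (by norm_num) ?_)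
  refine (lintegral_payment_le_virtualPart hM h0 hf hreg hx hp hfeas htruth hir).trans ?_
  exact sum_lintegral_threshold_le (D := fun _ => D₀) hM measurable_postedRevenue
    (K := fun i θ => ∫⁻ y in Set.Ioi (θ : ℝ), ENNReal.ofReal (virtualPart f D₀ y) ∂D₀ +
      revenueAtTop D₀)
    (fun i => (measurable_setLIntegral_Ioi_coe _ _).add_const _) (by norm_num)
    fun i t θ h => hf.lintegral_virtualPart_add_le h0 hreg h

end Matroid

theorem mainTheorem6 {n : ℕ} (M : Matroid (Fin n)) (hM : M.E = Set.univ) :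
    ∃ P : SingleSampleSPM n,
      P.Feasible M ∧ P.Truthful ∧
      (∀ (D : Fin n → Measure ℝ) [∀ i, IsProbabilityMeasure (D i)], (∀ i, IsMHRDist (D i)) →
        P.RevenueCompetitive M D (1 / (8 * Real.exp 1)) ∧
        P.WelfareCompetitive M D (1 / 8)) ∧
      (∀ (D₀ : Measure ℝ) [IsProbabilityMeasure D₀], IsRegularDist D₀ →
        P.RevenueCompetitive M (fun _ => D₀) (1 / 8)) := by
  refine ⟨M.sampleSPM, M.feasible_sampleSPM, M.sampleSPM.truthful, fun D _ hD => ⟨?_, ?_⟩,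
    fun D₀ _ hD => ?_⟩
  · exact Matroid.sampleSPM_revenueCompetitive_of_mhr hM hD
  · have hns : ∀ i, NullSingletonClass (D i) := fun i => by
      obtain ⟨_, f, hf, _⟩ := hD i
      exact hf.nullSingletonClass
    exact Matroid.sampleSPM_welfareCompetitive hM fun i => (hD i).1
  · exact Matroid.sampleSPM_revenueCompetitive_of_regular hM hD
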